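/- Let $X$ be a real Banach space. A $C^\infty$-blid map of $X$ is a $C^\infty$ (in the sense of Fréchet) map $H:X\to X$ with $\sup_{x\in X}\|H(x)\|<\infty$ and $H(x)=x$ for all $x$ in some neighbourhood of $0$. Suppose that $X$ has a $C^\infty$-blid map all of whose derivatives $H^{(n)}$, $n\ge 1$, are bounded on $X$. Let $A:X\to X$ be a continuous invertible linear operator that is hyperbolic, i.e. the spectrum of $A$ (that is, the spectrum of its complexification) does not intersect the unit circle of $\mathbb{C}$. Let $f:X\to\mathbb{C}$ be a $C^\infty$ function with $f(0)=0$ such that every derivative $f^{(n)}$ is bounded on every bounded subset of $X$. Suppose that the cohomological equation $$g(Ax)-g(x)=f(x),\qquad x\in X,\tag{1}$$ is formally solvable at $0$, meaning that for every $n\ge 1$ there is a continuous homogeneous polynomial $Q_n:X\to\mathbb{C}$ of degree $n$ (the restriction to the diagonal of a continuous real $n$-linear map) such that $$Q_n(Ax)-Q_n(x)=P_n(x)\quad\text{for all }x\in X,\qquad\text{where } P_n(x)=f^{(n)}(0)(x,\dots,x).$$ Then (1) has a global $C^\infty$ solution $g:X\to\mathbb{C}$. -/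

import Mathlib

open scoped ContDiff TensorProduct

namespace Blid

/-- `H` is a `C^q`-blid map of the real Banach space `X`: a globally defined, bounded `C^q`-map
which is the identity in a neighbourhood of zero. -/
structure IsBlidMap {X : Type*} [NormedAddCommGroup X] [NormedSpace ℝ X]
    (q : ℕ∞) (H : X → X) : Prop where
  contDiff : ContDiff ℝ q H
  bounded : ∃ C : ℝ, ∀ x, ‖H x‖ ≤ C
  eventually_eq_id : ∀ᶠ x in nhds (0 : X), H x = x

/-- On each bounded subset of `X`, every Fréchet derivative of `f` is bounded (the bound may depend
on the order of the derivative and on the subset). -/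
def DerivsBoundedOnBounded {X Y : Type*} [NormedAddCommGroup X] [NormedSpace ℝ X]
    [NormedAddCommGroup Y] [NormedSpace ℝ Y] (f : X → Y) : Prop :=
  ∀ n : ℕ, ∀ S : Set X, Bornology.IsBounded S →
    ∃ C : ℝ, ∀ x ∈ S, ‖iteratedFDeriv ℝ n f x‖ ≤ C

/-- Every Fréchet derivative of `f` is bounded on the whole of `X`. -/
def DerivsBounded {X Y : Type*} [NormedAddCommGroup X] [NormedSpace ℝ X]
    [NormedAddCommGroup Y] [NormedSpace ℝ Y] (f : X → Y) : Prop :=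
  ∀ n : ℕ, ∃ C : ℝ, ∀ x, ‖iteratedFDeriv ℝ n f x‖ ≤ C

/-- The (complex) spectrum of a bounded operator on a real Banach space: the spectrum of its
complexification, acting on `ℂ ⊗ X`. By the open mapping theorem, on a Banach space algebraic
invertibility of `A_ℂ - z` is the same as invertibility as a bounded operator. -/
noncomputable def complexSpectrum {X : Type*} [NormedAddCommGroup X] [NormedSpace ℝ X]
    (A : X →L[ℝ] X) : Set ℂ :=
  spectrum ℂ (LinearMap.baseChange ℂ (A : X →ₗ[ℝ] X) : Module.End ℂ (ℂ ⊗[ℝ] X))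

/-- `A` is hyperbolic: its spectrum does not intersect the unit circle of `ℂ`. -/
def IsHyperbolic {X : Type*} [NormedAddCommGroup X] [NormedSpace ℝ X]
    (A : X →L[ℝ] X) : Prop :=
  Disjoint (complexSpectrum A) (Metric.sphere (0 : ℂ) 1)

/-- `Q` is a continuous homogeneous polynomial map of degree `n`: the restriction to the diagonal
of a continuous `n`-linear map. -/
def IsContHomogPoly {X Y : Type*} [NormedAddCommGroup X] [NormedSpace ℝ X]
    [NormedAddCommGroup Y] [NormedSpace ℝ Y] (n : ℕ) (Q : X → Y) : Prop :=
  ∃ m : ContinuousMultilinearMap ℝ (fun _ : Fin n => X) Y, ∀ x, Q x = m (fun _ => x)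

/-- The homogeneous polynomial `P_n(x) = f^(n)(0)(x)^n`. -/
noncomputable def taylorForm {X Y : Type*} [NormedAddCommGroup X] [NormedSpace ℝ X]
    [NormedAddCommGroup Y] [NormedSpace ℝ Y] (f : X → Y) (n : ℕ) (x : X) : Y :=
  iteratedFDeriv ℝ n f 0 (fun _ => x)

/-- The equation `g (A x) - g x = f x` is formally solvable at zero: for every `n ≥ 1` the equation
`Q_n (A x) - Q_n x = P_n x` has a solution `Q_n` among the continuous homogeneous polynomials of
degree `n`. -/
def FormallySolvable {X Y : Type*} [NormedAddCommGroup X] [NormedSpace ℝ X]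
    [NormedAddCommGroup Y] [NormedSpace ℝ Y] (A : X →L[ℝ] X) (f : X → Y) : Prop :=
  ∀ n : ℕ, 1 ≤ n → ∃ Q : X → Y, IsContHomogPoly n Q ∧ ∀ x, Q (A x) - Q x = taylorForm f n x

end Blid

/-!
The proof has three ingredients.

* *Spectral splitting.* For a hyperbolic `A` the operators `(1 - A ^ 2 ^ k)⁻¹` converge to the
  projection `P` onto the stable subspace. They are averages of the resolvent over the `2 ^ k`-th
  roots of unity, that is, Riemann sums of the Riesz integral. The averaging is carried out in the
  real algebra, with the real part of the resolvent on the unit circle, so that no norm on the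
  complexification is needed (`exists_tendsto_inverse_one_sub`, `IsHyperbolic.exists_splitting`).
* *A Borel lemma.* A Banach space need not have smooth bump functions, but the rescaled blid maps
  `c⁻¹ H (c x)` can be inserted into homogeneous polynomials to cut them off. With `c` growing
  fast enough along the series one obtains a smooth function with bounded derivatives and
  prescribed Taylor series, also with parameters (`exists_borel_sum`).
* *Telescoping series.* If all derivatives of `g` vanish to infinite order along the unstable
  subspace `ker P`, then `-∑ g ∘ A^k` converges with all its derivatives on bounded sets, since
  `A^k x` approaches `ker P` geometrically, and solves the equation. For functions flat along the
  stable subspace the same applies to `A⁻¹` (`exists_solution_of_isFlatAlong`).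

The Borel sum of the formal solution reduces the theorem to the case where `f` is flat at the
origin (`exists_formal_correction`). Such an `f` is a sum of functions that are flat along the
stable or along the unstable subspace (`exists_isFlatAlong_add`): the part of `f` away from the
origin is split by applying the blid map in one variable at a time, and the part near the origin
by subtracting the Borel sum of its Taylor series along the unstable subspace.
-/

namespace Blid
open Filter Topology Asymptotics

/-! ### The spectral projection of a hyperbolic element of a real Banach algebra -/

section Spectral

open Polynomial

lemma commute_ringInverse_right {M : Type*} [MonoidWithZero M] {x y : M} (h : Commute x y) :
    Commute x (Ring.inverse y) := by
  by_cases hy : IsUnit y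
  · obtain ⟨u, rfl⟩ := hy
    rw [Ring.inverse_unit]
    exact h.units_inv_right
  · rw [Ring.inverse_non_unit _ hy]
    exact Commute.zero_right x

lemma tendsto_zero_of_norm_le_add_mul {x r e : ℕ → ℝ} (hx : ∀ k, 0 ≤ x k)
    (hr : Tendsto r atTop (𝓝 0)) (he : Tendsto e atTop (𝓝 0))
    (h : ∀ k, x k ≤ r k + x k * e k) : Tendsto x atTop (𝓝 0) := by
  have h2 : Tendsto (fun k => 2 * r k) atTop (𝓝 0) := by simpa using hr.const_mul 2
  refine squeeze_zero' (Eventually.of_forall hx) ?_ h2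
  filter_upwards [he.eventually_le_const (show (0 : ℝ) < 1 / 2 by norm_num)] with k hk
  have := mul_le_mul_of_nonneg_left hk (hx k)
  linarith [h k]

lemma mul_inverse_sq {M : Type*} [MonoidWithZero M] {x : M} (hx : IsUnit x) :
    x * Ring.inverse (x ^ 2) = Ring.inverse x := by
  obtain ⟨u, rfl⟩ := hx
  rw [← Units.val_pow_eq_pow_val, Ring.inverse_unit, Ring.inverse_unit, ← Units.val_mul]
  congr 1; group

/-- Convergence to zero along the powers `2 ^ k` forces geometric decay along all powers, since
`(a ^ n * p) ^ j = a ^ (n * j) * p`. -/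
lemma exists_geometric_bound {R : Type*} [NormedRing R] {a p : R} (hp : p * p = p)
    (hap : Commute a p)
    (h : Tendsto (fun k : ℕ => ‖a ^ 2 ^ k * p‖) atTop (𝓝 0)) :
    ∃ C q : ℝ, 0 < q ∧ q < 1 ∧ ∀ k : ℕ, ‖a ^ k * p‖ ≤ C * q ^ k := by
  obtain ⟨k₀, hk₀⟩ := (h.eventually_le_const (show (0 : ℝ) < 1 / 2 by norm_num)).exists
  set n := 2 ^ k₀ with hn
  have hn0 : 0 < n := by positivity
  -- the `n`-th root of `1 / 2`, where `‖a ^ n * p‖ ≤ 1 / 2`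
  set q : ℝ := (1 / 2 : ℝ) ^ ((n : ℝ)⁻¹) with hq
  have hqn : q ^ n = 1 / 2 := Real.rpow_inv_natCast_pow (by norm_num) hn0.ne'
  have hq0 : 0 < q := by positivity
  have hq1 : q < 1 := by
    by_contra! hc
    have := one_le_pow₀ (n := n) hc
    rw [hqn] at this; norm_num at this
  have hpow : ∀ j, ‖a ^ (n * j) * p‖ ≤ (‖p‖ + 1) * (q ^ n) ^ j := by
    intro j
    induction j with
    | zero => simp
    | succ j ih =>
      have : a ^ (n * (j + 1)) * p = a ^ n * p * (a ^ (n * j) * p) := by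
        rw [mul_assoc, ← mul_assoc p, ((hap.pow_left (n * j)).eq).symm, mul_assoc _ p p, hp,
          ← mul_assoc, ← pow_add]
        congr 2; ring
      rw [this, pow_succ, hqn]
      refine (norm_mul_le _ _).trans ?_
      have := mul_le_mul hk₀ ih (norm_nonneg _) (by norm_num)
      rw [hqn] at this
      linarith
  set M := ∑ r ∈ Finset.range n, ‖a ^ r‖ with hM
  refine ⟨M * (‖p‖ + 1) * 2, q, hq0, hq1, fun k => ?_⟩
  have hk : k = k % n + n * (k / n) := (Nat.mod_add_div k n).symm
  have h1 : ‖a ^ (k % n)‖ ≤ M :=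
    Finset.single_le_sum (f := fun r => ‖a ^ r‖) (fun _ _ => norm_nonneg _)
      (Finset.mem_range.2 (Nat.mod_lt _ hn0))
  have hM0 : 0 ≤ M := (norm_nonneg _).trans h1
  have h2 : (q ^ n) ^ (k / n) ≤ 2 * q ^ k := by
    conv_rhs => rw [hk, pow_add, pow_mul]
    have : 1 / 2 ≤ q ^ (k % n) := by
      rw [← hqn]; exact pow_le_pow_of_le_one hq0.le hq1.le (Nat.mod_lt _ hn0).le
    nlinarith [pow_pos (pow_pos hq0 n) (k / n)]
  calc ‖a ^ k * p‖ = ‖a ^ (k % n) * (a ^ (n * (k / n)) * p)‖ := by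
        rw [← mul_assoc, ← pow_add, ← hk]
    _ ≤ M * ((‖p‖ + 1) * (2 * q ^ k)) := by
        refine (norm_mul_le _ _).trans (mul_le_mul h1 ((hpow _).trans ?_) (norm_nonneg _) hM0)
        gcongr
    _ = _ := by ring

variable {R : Type*} [NormedRing R] [NormedAlgebra ℝ R]

/-- The real quadratic factor `(1 - e^{iθ} b) (1 - e^{-iθ} b) = 1 - 2 cos θ b + b²`. It is
invertible for every `θ` exactly when the spectrum of `b` misses the unit circle, and it makes
sense without complexifying. -/
noncomputable def quadFactor (b : R) (θ : ℝ) : R := 1 - (2 * Real.cos θ) • b + b ^ 2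

/-- The real part `(1 - cos θ b) (1 - 2 cos θ b + b²)⁻¹` of the resolvent `(1 - e^{iθ} b)⁻¹`. -/
noncomputable def reResolvent (b : R) (θ : ℝ) : R :=
  (1 - Real.cos θ • b) * Ring.inverse (quadFactor b θ)

/-- The factorization of `quadFactor` under doubling. Such identities hold between polynomials in
`b`, so they are transported from `ℝ[X]` along `aeval b`. -/
lemma quadFactor_sq (b : R) (θ : ℝ) :
    quadFactor (b ^ 2) (2 * θ) = quadFactor b θ * quadFactor b (θ + Real.pi) := by
  have h := congrArg (aeval b) (show
    (1 - C (2 * (2 * Real.cos θ ^ 2 - 1)) * (X ^ 2 : ℝ[X]) + (X ^ 2) ^ 2)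
    = (1 - C (2 * Real.cos θ) * X + X ^ 2) * (1 - C (2 * -Real.cos θ) * X + X ^ 2) by
      simp only [map_mul, map_sub, map_neg, map_pow, map_one, map_ofNat]; ring)
  simpa [quadFactor, Real.cos_two_mul, Real.cos_add_pi, Algebra.smul_def] using h

/-- The same factorization as `quadFactor_sq` with the two (commuting) factors exchanged. -/
lemma quadFactor_sq' (b : R) (θ : ℝ) :
    quadFactor (b ^ 2) (2 * θ) = quadFactor b (θ + Real.pi) * quadFactor b θ := by
  have h := congrArg (aeval b) (show
    (1 - C (2 * (2 * Real.cos θ ^ 2 - 1)) * (X ^ 2 : ℝ[X]) + (X ^ 2) ^ 2)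
    = (1 - C (2 * -Real.cos θ) * X + X ^ 2) * (1 - C (2 * Real.cos θ) * X + X ^ 2) by
      simp only [map_mul, map_sub, map_neg, map_pow, map_one, map_ofNat]; ring)
  simpa [quadFactor, Real.cos_two_mul, Real.cos_add_pi, Algebra.smul_def] using h

/-- The real form of `1 / (1 - z²) = (1 / (1 - z) + 1 / (1 + z)) / 2`. -/
lemma reResolvent_sq {b : R} (hb : ∀ θ, IsUnit (quadFactor b θ)) (θ : ℝ) :
    reResolvent (b ^ 2) (2 * θ) =
      (1 / 2 : ℝ) • (reResolvent b θ + reResolvent b (θ + Real.pi)) := by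
  have hu : IsUnit (quadFactor (b ^ 2) (2 * θ)) := by
    rw [quadFactor_sq]; exact (hb _).mul (hb _)
  refine hu.mul_right_cancel ?_
  rw [reResolvent, mul_assoc, Ring.inverse_mul_cancel _ hu, smul_mul_assoc, add_mul]
  conv_rhs => enter [2, 1]; rw [quadFactor_sq]
  conv_rhs => enter [2, 2]; rw [quadFactor_sq']
  rw [reResolvent, reResolvent, mul_assoc, ← mul_assoc (Ring.inverse _),
    Ring.inverse_mul_cancel _ (hb _), mul_assoc _ (Ring.inverse (quadFactor b (θ + Real.pi))),
    ← mul_assoc (Ring.inverse (quadFactor b (θ + Real.pi))), Ring.inverse_mul_cancel _ (hb _)]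
  have h := congrArg (aeval b) (show (1 - C (2 * Real.cos θ ^ 2 - 1) * (X ^ 2 : ℝ[X]))
    = C (1 / 2) * ((1 - C (Real.cos θ) * X) * (1 - C (2 * -Real.cos θ) * X + X ^ 2) +
      (1 - C (-Real.cos θ) * X) * (1 - C (2 * Real.cos θ) * X + X ^ 2)) by
      have : (C (1 / 2 : ℝ) : ℝ[X]) * 2 = 1 := by
        rw [← map_ofNat C 2, ← map_mul]; norm_num
      simp only [map_mul, map_sub, map_neg, map_pow, map_one, map_ofNat]
      linear_combination (-1 + (2 * C (Real.cos θ) ^ 2 - 1) * X ^ 2) * this )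
  simpa [quadFactor, Real.cos_two_mul, Real.cos_add_pi, Algebra.smul_def] using h

lemma isUnit_quadFactor_sq {b : R} (hb : ∀ θ, IsUnit (quadFactor b θ)) (θ : ℝ) :
    IsUnit (quadFactor (b ^ 2) θ) := by
  rw [show θ = 2 * (θ / 2) by ring, quadFactor_sq]
  exact (hb _).mul (hb _)

lemma isUnit_quadFactor_pow {a : R} (ha : ∀ θ, IsUnit (quadFactor a θ)) (k : ℕ) :
    ∀ θ, IsUnit (quadFactor (a ^ 2 ^ k) θ) := by
  induction k with
  | zero => simpa using ha
  | succ k ih => rw [pow_succ 2, pow_mul]; exact isUnit_quadFactor_sq ih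

lemma quadFactor_zero (b : R) : quadFactor b 0 = (1 - b) ^ 2 := by
  have h := congrArg (aeval b) (show (1 - C (2 * 1 : ℝ) * X + X ^ 2 : ℝ[X]) = (1 - X) ^ 2 by
    simp only [map_mul, map_one, map_ofNat]; ring)
  simpa [quadFactor, Algebra.smul_def] using h

lemma quadFactor_pi (b : R) : quadFactor b Real.pi = (1 + b) ^ 2 := by
  have h := congrArg (aeval b) (show (1 - C (2 * -1 : ℝ) * X + X ^ 2 : ℝ[X]) = (1 + X) ^ 2 by
    simp only [map_mul, map_neg, map_one, map_ofNat]; ring)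
  simpa [quadFactor, Algebra.smul_def] using h

lemma reResolvent_zero {b : R} (hb : IsUnit (1 - b)) : reResolvent b 0 = Ring.inverse (1 - b) := by
  rw [reResolvent, quadFactor_zero, Real.cos_zero, one_smul, mul_inverse_sq hb]

lemma reResolvent_pi {b : R} (hb : IsUnit (1 + b)) :
    reResolvent b Real.pi = Ring.inverse (1 + b) := by
  rw [reResolvent, quadFactor_pi, Real.cos_pi, neg_one_smul, sub_neg_eq_add, mul_inverse_sq hb]

lemma isUnit_one_sub_of_quadFactor {b : R} (hb : ∀ θ, IsUnit (quadFactor b θ)) :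
    IsUnit (1 - b) := by
  have := hb 0
  rw [quadFactor_zero] at this
  exact (isUnit_pow_iff two_ne_zero).1 this

lemma isUnit_one_add_of_quadFactor {b : R} (hb : ∀ θ, IsUnit (quadFactor b θ)) :
    IsUnit (1 + b) := by
  have := hb Real.pi
  rw [quadFactor_pi] at this
  exact (isUnit_pow_iff two_ne_zero).1 this

/-- Passing from `b` to `b ^ 2` averages `reResolvent` over `θ / 2` and `θ / 2 + π`, which halves
its Lipschitz constant. -/
lemma lipschitz_reResolvent_pow {a : R} (ha : ∀ θ, IsUnit (quadFactor a θ)) {L : ℝ}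
    (hL : ∀ s t, ‖reResolvent a s - reResolvent a t‖ ≤ L * |s - t|) (k : ℕ) :
    ∀ s t, ‖reResolvent (a ^ 2 ^ k) s - reResolvent (a ^ 2 ^ k) t‖ ≤ L / 2 ^ k * |s - t| := by
  induction k with
  | zero => simpa using hL
  | succ k ih =>
    intro s t
    rw [pow_succ 2, pow_mul, show s = 2 * (s / 2) by ring, show t = 2 * (t / 2) by ring,
      reResolvent_sq (isUnit_quadFactor_pow ha k), reResolvent_sq (isUnit_quadFactor_pow ha k),
      ← smul_sub, norm_smul, add_sub_add_comm, Real.norm_of_nonneg (by norm_num)]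
    have h1 := ih (s / 2) (t / 2)
    have h2 := ih (s / 2 + Real.pi) (t / 2 + Real.pi)
    rw [add_sub_add_right_eq_sub] at h2
    have h3 : |2 * (s / 2) - 2 * (t / 2)| = 2 * |s / 2 - t / 2| := by
      rw [← mul_sub, abs_mul, abs_two]
    calc _ ≤ 1 / 2 * (L / 2 ^ k * |s / 2 - t / 2| + L / 2 ^ k * |s / 2 - t / 2|) := by
          gcongr; exact (norm_add_le _ _).trans (add_le_add h1 h2)
      _ = _ := by rw [h3, pow_succ]; ring

variable [CompleteSpace R]

/-- The inverse of `quadFactor a θ` is continuous and periodic in `θ`, hence bounded; the resolvent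
identity then makes `reResolvent a` Lipschitz. -/
lemma exists_lipschitz_reResolvent {a : R} (ha : ∀ θ, IsUnit (quadFactor a θ)) :
    ∃ L : ℝ, ∀ s t, ‖reResolvent a s - reResolvent a t‖ ≤ L * |s - t| := by
  have hcq : Continuous (quadFactor a) := by unfold quadFactor; fun_prop
  have hc : Continuous fun θ => Ring.inverse (quadFactor a θ) :=
    continuous_iff_continuousAt.2 fun θ => by
      obtain ⟨u, hu⟩ := ha θ
      have h1 : ContinuousAt Ring.inverse (quadFactor a θ) := by
        rw [← hu]; exact NormedRing.inverse_continuousAt u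
      exact ContinuousAt.comp (f := quadFactor a) h1 hcq.continuousAt
  obtain ⟨M, hM⟩ : ∃ M, ∀ θ, ‖Ring.inverse (quadFactor a θ)‖ ≤ M := by
    obtain ⟨M, hM⟩ := (isCompact_Icc (a := 0) (b := 2 * Real.pi)).exists_bound_of_continuousOn
      hc.continuousOn
    refine ⟨M, fun θ => ?_⟩
    obtain ⟨y, hy, hyθ⟩ := (show Function.Periodic
      (fun θ => Ring.inverse (quadFactor a θ)) (2 * Real.pi) from
        fun θ => by simp [quadFactor]).exists_mem_Ico₀ Real.two_pi_pos θ
    rw [hyθ]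
    exact hM y (Set.Ico_subset_Icc_self hy)
  have hM0 : 0 ≤ M := (norm_nonneg _).trans (hM 0)
  have hcos : ∀ s t, |Real.cos s - Real.cos t| ≤ |s - t| := fun s t =>
    Real.abs_cos_sub_cos_le s t
  refine ⟨‖a‖ * M + (‖(1 : R)‖ + ‖a‖) * (M * (2 * ‖a‖) * M), fun s t => ?_⟩
  set u := Ring.inverse (quadFactor a s) with hu
  set v := Ring.inverse (quadFactor a t) with hv
  have huv : u - v = u * ((2 * (Real.cos s - Real.cos t)) • a) * v := by
    have h1 : (2 * (Real.cos s - Real.cos t)) • a = quadFactor a t - quadFactor a s := by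
      simp only [quadFactor, mul_sub, sub_smul]; abel
    rw [h1, mul_sub, sub_mul, Ring.inverse_mul_cancel _ (ha s), mul_assoc,
      Ring.mul_inverse_cancel _ (ha t), mul_one, one_mul]
  have key : reResolvent a s - reResolvent a t =
      (-(Real.cos s - Real.cos t) • a) * u + (1 - Real.cos t • a) * (u - v) := by
    simp only [reResolvent, ← hu, ← hv, sub_smul, neg_sub, sub_mul, mul_sub]; abel
  have h1 : ‖(-(Real.cos s - Real.cos t) • a) * u‖ ≤ |s - t| * ‖a‖ * M := by
    refine (norm_mul_le _ _).trans ?_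
    rw [norm_smul, norm_neg, Real.norm_eq_abs]
    exact mul_le_mul (mul_le_mul_of_nonneg_right (hcos s t) (norm_nonneg _)) (hM s)
      (norm_nonneg _) (by positivity)
  have h2 : ‖u - v‖ ≤ M * (2 * |s - t| * ‖a‖) * M := by
    rw [huv]
    refine (norm_mul_le _ _).trans ?_
    refine mul_le_mul ((norm_mul_le _ _).trans ?_) (hM t) (norm_nonneg _) (by positivity)
    rw [norm_smul, norm_mul, Real.norm_eq_abs, Real.norm_eq_abs, abs_two]
    exact mul_le_mul (hM s) (mul_le_mul_of_nonneg_right (mul_le_mul_of_nonneg_left (hcos s t)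
      zero_le_two) (norm_nonneg _)) (by positivity) hM0
  have h3 : ‖1 - Real.cos t • a‖ ≤ ‖(1 : R)‖ + ‖a‖ := by
    refine (norm_sub_le _ _).trans ?_
    gcongr
    rw [norm_smul]
    exact mul_le_of_le_one_left (norm_nonneg _) (Real.abs_cos_le_one t)
  rw [key]
  refine (norm_add_le _ _).trans ((add_le_add h1 ((norm_mul_le _ _).trans
    (mul_le_mul h3 h2 (norm_nonneg _) (by positivity)))).trans (le_of_eq ?_))
  ring

/-- The elements `(1 - a ^ 2 ^ k)⁻¹` and `(1 + a ^ 2 ^ k)⁻¹` are the values of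
`reResolvent (a ^ 2 ^ k)` at `0` and `π`. Since the oscillation of this function decays like
`2 ^ (-k)`, both sequences converge, to the same limit. -/
lemma exists_tendsto_inverse_one_sub {a : R} (ha : ∀ θ, IsUnit (quadFactor a θ)) :
    ∃ p : R, Tendsto (fun k : ℕ => Ring.inverse (1 - a ^ 2 ^ k)) atTop (𝓝 p) ∧
      Tendsto (fun k : ℕ => Ring.inverse (1 + a ^ 2 ^ k)) atTop (𝓝 p) := by
  obtain ⟨L, hL⟩ := exists_lipschitz_reResolvent ha
  have hLk := lipschitz_reResolvent_pow ha hL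
  have hu := fun k => isUnit_quadFactor_pow ha k
  have h0 : ∀ k, Ring.inverse (1 - a ^ 2 ^ k) = reResolvent (a ^ 2 ^ k) 0 := fun k =>
    (reResolvent_zero (isUnit_one_sub_of_quadFactor (hu k))).symm
  have hpi : ∀ k, Ring.inverse (1 + a ^ 2 ^ k) = reResolvent (a ^ 2 ^ k) Real.pi := fun k =>
    (reResolvent_pi (isUnit_one_add_of_quadFactor (hu k))).symm
  simp only [h0, hpi]
  have hd : ∀ k, ‖reResolvent (a ^ 2 ^ k) Real.pi - reResolvent (a ^ 2 ^ k) 0‖ ≤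
      L * Real.pi / 2 ^ k := fun k => by
    refine (hLk k _ _).trans (le_of_eq ?_)
    rw [sub_zero, abs_of_pos Real.pi_pos]; ring
  have hC : CauchySeq fun k => reResolvent (a ^ 2 ^ k) 0 := by
    refine cauchySeq_of_le_geometric_two (C := L * Real.pi) fun k => ?_
    rw [dist_comm, dist_eq_norm, pow_succ 2 k, pow_mul]
    have h1 := reResolvent_sq (hu k) 0
    rw [mul_zero, zero_add] at h1
    rw [h1, show (1 / 2 : ℝ) • (reResolvent (a ^ 2 ^ k) 0 + reResolvent (a ^ 2 ^ k) Real.pi) -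
      reResolvent (a ^ 2 ^ k) 0 = (1 / 2 : ℝ) • (reResolvent (a ^ 2 ^ k) Real.pi -
        reResolvent (a ^ 2 ^ k) 0) by module, norm_smul, Real.norm_of_nonneg (by norm_num)]
    have := hd k
    calc _ ≤ 1 / 2 * (L * Real.pi / 2 ^ k) := by gcongr
      _ = _ := by ring
  obtain ⟨p, hp⟩ := cauchySeq_tendsto_of_complete hC
  refine ⟨p, hp, ?_⟩
  have hz : Tendsto (fun k : ℕ => reResolvent (a ^ 2 ^ k) Real.pi - reResolvent (a ^ 2 ^ k) 0)
      atTop (𝓝 0) := by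
    refine squeeze_zero_norm hd ?_
    have := (tendsto_pow_atTop_nhds_zero_of_lt_one (r := (1 / 2 : ℝ)) (by norm_num)
      (by norm_num)).const_mul (L * Real.pi)
    simpa [div_eq_mul_inv] using this
  simpa using hz.add hp

/-- The spectral projection `p` belonging to the part of the spectrum of `a` inside the unit disc is
the limit of `e k = (1 - a ^ 2 ^ k)⁻¹`. It is idempotent because
`e (k + 1) = (1 + a ^ 2 ^ k)⁻¹ * e k`, and the powers of `a` and of its inverse `c` tend to zero on
the two summands because `a ^ 2 ^ k * e k = e k - 1`. -/
theorem exists_dichotomy_projection {a c : R} (hac : a * c = 1) (hca : c * a = 1)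
    (ha : ∀ θ, IsUnit (quadFactor a θ)) :
    ∃ p : R, p * p = p ∧ Commute a p ∧
      Tendsto (fun k : ℕ => ‖a ^ 2 ^ k * p‖) atTop (𝓝 0) ∧
      Tendsto (fun k : ℕ => ‖c ^ 2 ^ k * (1 - p)‖) atTop (𝓝 0) := by
  obtain ⟨p, hp, hp'⟩ := exists_tendsto_inverse_one_sub ha
  have hu := fun k => isUnit_quadFactor_pow ha k
  have hu1 := fun k => isUnit_one_sub_of_quadFactor (hu k)
  set e : ℕ → R := fun k => Ring.inverse (1 - a ^ 2 ^ k) with he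
  have hae : ∀ k, Commute a (e k) := fun k =>
    commute_ringInverse_right ((Commute.one_right a).sub_right ((Commute.refl a).pow_right _))
  have hap : Commute a p :=
    tendsto_nhds_unique (hp.const_mul a) (by simpa only [(hae _).eq] using hp.mul_const a)
  have hpp : p * p = p := by
    refine tendsto_nhds_unique (hp'.mul hp) (((tendsto_add_atTop_iff_nat 1).2 hp).congr fun k => ?_)
    have h1 : (1 - a ^ 2 ^ (k + 1)) = (1 - a ^ 2 ^ k) * (1 + a ^ 2 ^ k) := by
      rw [pow_succ 2, pow_mul]; noncomm_ring
    simp only [he, h1]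
    exact Ring.mul_inverse_rev' (by
      rw [Commute, SemiconjBy]; noncomm_ring)
  have hep : ∀ k, Commute p (e k) := fun k =>
    commute_ringInverse_right ((Commute.one_right p).sub_right (hap.symm.pow_right _))
  have hbe : ∀ k, a ^ 2 ^ k * e k = e k - 1 := fun k => by
    have := Ring.mul_inverse_cancel _ (hu1 k)
    rw [sub_mul, one_mul] at this
    rw [eq_sub_iff_add_eq', ← this]; simp only [he]; abel
  have hcb : ∀ k, c ^ 2 ^ k * a ^ 2 ^ k = 1 := fun k => by
    rw [← (show Commute c a from hca.trans hac.symm).mul_pow, hca, one_pow]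
  have hce : ∀ k, c ^ 2 ^ k * (1 - e k) = - e k := fun k => by
    rw [← neg_sub, ← hbe, mul_neg, ← mul_assoc, hcb, one_mul]
  refine ⟨p, hpp, hap, ?_, ?_⟩
  · have hr : Tendsto (fun k => ‖(e k - 1) * p‖) atTop (𝓝 0) := by
      have := ((hp.sub_const 1).mul_const p).norm
      rwa [sub_mul, one_mul, hpp, sub_self, norm_zero] at this
    have hE : Tendsto (fun k => ‖p - e k * p‖) atTop (𝓝 0) := by
      have := ((hp.mul_const p).const_sub p).norm
      rwa [hpp, sub_self, norm_zero] at this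
    refine tendsto_zero_of_norm_le_add_mul (fun _ => norm_nonneg _) hr hE fun k => ?_
    have h1 : a ^ 2 ^ k * p = (e k - 1) * p + a ^ 2 ^ k * p * (p - e k * p) := by
      have h2 : a ^ 2 ^ k * p * (e k * p) = a ^ 2 ^ k * e k * p := by
        rw [← mul_assoc, mul_assoc _ p, (hep k).eq, mul_assoc, mul_assoc, hpp, mul_assoc]
      rw [← hbe, mul_sub, h2, mul_assoc _ p p, hpp]
      abel
    calc _ = ‖(e k - 1) * p + a ^ 2 ^ k * p * (p - e k * p)‖ := by rw [← h1]
      _ ≤ _ := (norm_add_le _ _).trans (add_le_add le_rfl (norm_mul_le _ _))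
  · have hr : Tendsto (fun k => ‖e k * (1 - p)‖) atTop (𝓝 0) := by
      have := (hp.mul_const (1 - p)).norm
      rwa [mul_sub, mul_one, hpp, sub_self, norm_zero] at this
    refine tendsto_zero_of_norm_le_add_mul (fun _ => norm_nonneg _) hr hr fun k => ?_
    have hq : (1 - p) * (1 - p) = 1 - p := by
      exact IsIdempotentElem.one_sub hpp
    have h1 : c ^ 2 ^ k * (1 - p) = -(e k * (1 - p)) + c ^ 2 ^ k * (1 - p) * (e k * (1 - p)) := by
      have hqe : Commute (1 - p) (e k) := (Commute.one_left _).sub_left (hep k)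
      have h2 : c ^ 2 ^ k * (1 - p) * (e k * (1 - p)) = c ^ 2 ^ k * e k * (1 - p) := by
        rw [← mul_assoc, mul_assoc _ (1 - p), hqe.eq, mul_assoc, mul_assoc, hq, mul_assoc]
      rw [h2, ← neg_mul, ← hce k, ← add_mul, ← mul_add, sub_add_cancel, mul_one]
    calc _ = ‖-(e k * (1 - p)) + c ^ 2 ^ k * (1 - p) * (e k * (1 - p))‖ := by rw [← h1]
      _ ≤ _ := (norm_add_le _ _).trans (by rw [norm_neg]; exact add_le_add le_rfl (norm_mul_le _ _))

end Spectral

/-! ### The stable and unstable subspaces of a hyperbolic operator -/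

section Operator
variable {X : Type*} [NormedAddCommGroup X] [NormedSpace ℝ X]

lemma isUnit_sub_baseChange {A : X →L[ℝ] X} (hA : IsHyperbolic A) {w : ℂ} (hw : ‖w‖ = 1) :
    IsUnit (algebraMap ℂ (Module.End ℂ (ℂ ⊗[ℝ] X)) w -
      LinearMap.baseChange ℂ (A : X →ₗ[ℝ] X)) := by
  by_contra h
  exact Set.disjoint_left.1 hA (show w ∈ complexSpectrum A from h) (by simpa using hw)

variable [CompleteSpace X]

/-- After base change to `ℂ`, `quadFactor A θ` is `(w - A) (w̄ - A)` with `w = e^{iθ}`, hence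
bijective. Bijectivity descends because `ℂ` is faithfully flat over `ℝ`, and the open mapping
theorem gives a bounded inverse. -/
lemma isUnit_quadFactor_of_isHyperbolic {A : X →L[ℝ] X} (hA : IsHyperbolic A) (θ : ℝ) :
    IsUnit (quadFactor A θ) := by
  set w : ℂ := Complex.exp (θ * Complex.I) with hw
  have hwn : ‖w‖ = 1 := Complex.norm_exp_ofReal_mul_I θ
  have hwc : ‖(starRingEnd ℂ) w‖ = 1 := by rw [RCLike.norm_conj, hwn]
  have hprod := (isUnit_sub_baseChange hA hwn).mul (isUnit_sub_baseChange hA hwc)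
  have h1 : w * (starRingEnd ℂ) w = 1 := by
    rw [Complex.mul_conj, Complex.normSq_eq_norm_sq, hwn]; norm_num
  have h2 : w + (starRingEnd ℂ) w = ((2 * Real.cos θ : ℝ) : ℂ) := by
    rw [Complex.add_conj, hw, Complex.exp_ofReal_mul_I_re]
  have key : (algebraMap ℂ (Module.End ℂ (ℂ ⊗[ℝ] X)) w - LinearMap.baseChange ℂ (A : X →ₗ[ℝ] X)) *
      (algebraMap ℂ (Module.End ℂ (ℂ ⊗[ℝ] X)) ((starRingEnd ℂ) w) -
        LinearMap.baseChange ℂ (A : X →ₗ[ℝ] X)) =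
      LinearMap.baseChange ℂ ((quadFactor A θ : X →L[ℝ] X) : X →ₗ[ℝ] X) := by
    ext x
    have h3 : (starRingEnd ℂ) w • w • ((1 : ℂ) ⊗ₜ[ℝ] x) = (1 : ℂ) ⊗ₜ[ℝ] x := by
      rw [smul_smul, mul_comm, h1, one_smul]
    have h4 : w • ((1 : ℂ) ⊗ₜ[ℝ] A x) + (starRingEnd ℂ) w • ((1 : ℂ) ⊗ₜ[ℝ] A x) =
        (1 : ℂ) ⊗ₜ[ℝ] ((2 * Real.cos θ) • A x) := by
      rw [← add_smul, h2, ← TensorProduct.smul_tmul, TensorProduct.smul_tmul', smul_eq_mul, mul_one,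
        Complex.real_smul, mul_one]
    simp only [quadFactor, Module.algebraMap_end_apply, Module.End.mul_apply, LinearMap.sub_apply,
      LinearMap.baseChange_tmul, map_sub, map_smul, TensorProduct.AlgebraTensorModule.curry_apply,
      TensorProduct.curry_apply, LinearMap.coe_restrictScalars,
      ContinuousLinearMap.coe_coe, add_apply, sub_apply, smul_apply, one_apply_eq_self, pow_two,
      mul_apply_eq_comp, TensorProduct.tmul_add, TensorProduct.tmul_sub]
    rw [smul_sub, h3, ← h4]
    abel
  rw [key, Module.End.isUnit_iff] at hprod
  have hbij : Function.Bijective (quadFactor A θ : X →L[ℝ] X) :=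
    (Module.FaithfullyFlat.lTensor_bijective_iff_bijective ℝ ℂ
      ((quadFactor A θ : X →L[ℝ] X) : X →ₗ[ℝ] X)).1 hprod
  rw [ContinuousLinearMap.isUnit_iff_bijective]
  exact hbij

/-- The hyperbolic splitting: a bounded projection `P` commuting with `A` such that `A` contracts
the range of `P` and `A⁻¹` contracts its kernel, at a geometric rate. -/
theorem IsHyperbolic.exists_splitting {A : X ≃L[ℝ] X} (hA : IsHyperbolic (A : X →L[ℝ] X)) :
    ∃ (P : X →L[ℝ] X) (C q : ℝ), (∀ x, P (P x) = P x) ∧ (∀ x, A (P x) = P (A x)) ∧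
      0 < q ∧ q < 1 ∧
      (∀ (k : ℕ) x, ‖(A : X → X)^[k] (P x)‖ ≤ C * q ^ k * ‖x‖) ∧
      ∀ (k : ℕ) x, ‖(A.symm : X → X)^[k] (x - P x)‖ ≤ C * q ^ k * ‖x‖ := by
  obtain ⟨P, hPP, hAP, h1, h2⟩ := exists_dichotomy_projection
    (a := (A : X →L[ℝ] X)) (c := (A.symm : X →L[ℝ] X)) (by ext; simp) (by ext; simp)
    (isUnit_quadFactor_of_isHyperbolic hA)
  have hcP : Commute (A.symm : X →L[ℝ] X) P := by
    ext x
    have := congrArg (fun T : X →L[ℝ] X => A.symm (T (A.symm x))) hAP.eq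
    simpa using this.symm
  obtain ⟨C₁, q₁, hq₁, hq₁', hb₁⟩ := exists_geometric_bound hPP hAP h1
  obtain ⟨C₂, q₂, hq₂, hq₂', hb₂⟩ := exists_geometric_bound (p := 1 - P)
    (IsIdempotentElem.one_sub hPP)
    ((Commute.one_right _).sub_right hcP) h2
  have hC₁ : 0 ≤ C₁ := by simpa using (norm_nonneg _).trans (hb₁ 0)
  have hC₂ : 0 ≤ C₂ := by simpa using (norm_nonneg _).trans (hb₂ 0)
  refine ⟨P, max C₁ C₂, max q₁ q₂, fun x => DFunLike.congr_fun hPP x,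
    fun x => DFunLike.congr_fun hAP.eq x, lt_max_of_lt_left hq₁, max_lt hq₁' hq₂', ?_, ?_⟩
  · intro k x
    have : (A : X → X)^[k] (P x) = ((A : X →L[ℝ] X) ^ k * P) x := by
      simp
    rw [this]
    refine (ContinuousLinearMap.le_opNorm _ _).trans ?_
    gcongr
    refine (hb₁ k).trans ?_
    gcongr
    exacts [le_max_left _ _, le_max_left _ _]
  · intro k x
    have : (A.symm : X → X)^[k] (x - P x) = ((A.symm : X →L[ℝ] X) ^ k * (1 - P)) x := by
      simp
    rw [this]
    refine (ContinuousLinearMap.le_opNorm _ _).trans ?_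
    gcongr
    refine (hb₂ k).trans ?_
    gcongr
    exacts [le_max_right _ _, le_max_right _ _]

end Operator

/-! ### Smooth maps with bounded derivatives -/

section Calculus
variable {E F G : Type*} [NormedAddCommGroup E] [NormedSpace ℝ E]
  [NormedAddCommGroup F] [NormedSpace ℝ F] [NormedAddCommGroup G] [NormedSpace ℝ G]

/-- A `C^∞` map all of whose derivatives, including the map itself, are bounded. -/
structure IsSmoothBounded (f : E → F) : Prop where
  contDiff : ContDiff ℝ ∞ f
  bounded : DerivsBounded f

lemma natCast_le_infty (n : ℕ) : (n : WithTop ℕ∞) ≤ ∞ := by exact_mod_cast le_top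

lemma isSmoothBounded_const (c : F) : IsSmoothBounded fun _ : E => c := by
  refine ⟨contDiff_const, fun n => ⟨‖c‖, fun x => ?_⟩⟩
  rcases eq_or_ne n 0 with rfl | hn
  · rw [norm_iteratedFDeriv_zero]
  · rw [iteratedFDeriv_const_of_ne hn]; simp

/-- Separating the first variable of a continuous multilinear map, as a continuous linear map. -/
noncomputable def curryLeftCLM (n : ℕ) (F G : Type*) [NormedAddCommGroup F] [NormedSpace ℝ F]
    [NormedAddCommGroup G] [NormedSpace ℝ G] :
    (F [×n + 1]→L[ℝ] G) →L[ℝ] F →L[ℝ] F [×n]→L[ℝ] G :=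
  (continuousMultilinearCurryLeftEquiv ℝ (fun _ : Fin (n + 1) => F)
    G).toContinuousLinearEquiv.toContinuousLinearMap

lemma curryLeftCLM_apply_diag (n : ℕ) (m : F [×n + 1]→L[ℝ] G) (x : F) :
    (curryLeftCLM n F G m x fun _ => x) = m fun _ => x := by
  refine congrArg m (funext fun i => ?_)
  refine Fin.cases ?_ (fun j => ?_) i <;> simp

namespace IsSmoothBounded

lemma clm_comp {f : E → F} (hf : IsSmoothBounded f) (L : F →L[ℝ] G) :
    IsSmoothBounded fun x => L (f x) := by
  refine ⟨L.contDiff.comp hf.contDiff, fun n => ?_⟩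
  obtain ⟨C, hC⟩ := hf.bounded n
  refine ⟨‖L‖ * C, fun x => ?_⟩
  exact (L.norm_iteratedFDeriv_comp_left hf.contDiff.contDiffAt (natCast_le_infty n)).trans
    (mul_le_mul_of_nonneg_left (hC x) (norm_nonneg _))

end IsSmoothBounded

lemma norm_iteratedFDeriv_comp_clm_le {f : F → G} (hf : ContDiff ℝ ∞ f) (L : E →L[ℝ] F)
    (n : ℕ) (x : E) :
    ‖iteratedFDeriv ℝ n (fun y => f (L y)) x‖ ≤ ‖iteratedFDeriv ℝ n f (L x)‖ * ‖L‖ ^ n := by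
  have := L.iteratedFDeriv_comp_right hf x (natCast_le_infty n)
  rw [Function.comp_def] at this
  rw [this]
  refine (ContinuousMultilinearMap.norm_compContinuousLinearMap_le _ _).trans (le_of_eq ?_)
  simp

namespace IsSmoothBounded

lemma comp_clm {f : F → G} (hf : IsSmoothBounded f) (L : E →L[ℝ] F) :
    IsSmoothBounded fun x => f (L x) := by
  refine ⟨hf.contDiff.comp L.contDiff, fun n => ?_⟩
  obtain ⟨C, hC⟩ := hf.bounded n
  refine ⟨C * ‖L‖ ^ n, fun x => (norm_iteratedFDeriv_comp_clm_le hf.contDiff L n x).trans ?_⟩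
  gcongr
  exact hC _

lemma add {f g : E → F} (hf : IsSmoothBounded f) (hg : IsSmoothBounded g) :
    IsSmoothBounded fun x => f x + g x := by
  refine ⟨hf.contDiff.add hg.contDiff, fun n => ?_⟩
  obtain ⟨C, hC⟩ := hf.bounded n
  obtain ⟨D, hD⟩ := hg.bounded n
  refine ⟨C + D, fun x => ?_⟩
  rw [fun_iteratedFDeriv_add_apply (hf.contDiff.of_le (natCast_le_infty n)).contDiffAt
    (hg.contDiff.of_le (natCast_le_infty n)).contDiffAt]
  exact (norm_add_le _ _).trans (add_le_add (hC x) (hD x))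

lemma neg {f : E → F} (hf : IsSmoothBounded f) : IsSmoothBounded fun x => - f x := by
  simpa using hf.clm_comp (-ContinuousLinearMap.id ℝ F)

lemma sub {f g : E → F} (hf : IsSmoothBounded f) (hg : IsSmoothBounded g) :
    IsSmoothBounded fun x => f x - g x := by
  simpa [sub_eq_add_neg] using hf.add hg.neg

lemma clm_apply {u : E → F →L[ℝ] G} {h : E → F} (hu : IsSmoothBounded u)
    (hh : IsSmoothBounded h) : IsSmoothBounded fun x => u x (h x) := by
  refine ⟨hu.contDiff.clm_apply hh.contDiff, fun n => ?_⟩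
  choose C hC using hu.bounded
  choose D hD using hh.bounded
  refine ⟨∑ i ∈ Finset.range (n + 1), (n.choose i : ℝ) * C i * D (n - i), fun x => ?_⟩
  refine (norm_iteratedFDeriv_clm_apply hu.contDiff hh.contDiff x (natCast_le_infty n)).trans ?_
  gcongr with i hi
  · exact mul_nonneg (Nat.cast_nonneg _) ((norm_nonneg _).trans (hC i x))
  · exact hC i x
  · exact hD _ x

lemma apply_diag {n : ℕ} {u : E → ContinuousMultilinearMap ℝ (fun _ : Fin n => F) G} {h : E → F}
    (hu : IsSmoothBounded u) (hh : IsSmoothBounded h) :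
    IsSmoothBounded fun x => u x fun _ => h x := by
  induction n with
  | zero =>
    have := hu.clm_comp
      (continuousMultilinearCurryFin0 ℝ F G).toContinuousLinearEquiv.toContinuousLinearMap
    convert this using 2 with x
    exact congrArg (u x) (Subsingleton.elim _ _)
  | succ n ih =>
    have h1 := ih ((hu.clm_comp (curryLeftCLM n F G)).clm_apply hh)
    simpa only [curryLeftCLM_apply_diag] using h1

/-- The `n`-th derivative of `f ∘ h` is controlled by the derivatives of `f` up to order `n`, with a
factor depending only on `h` and `n`. -/
lemma exists_norm_iteratedFDeriv_comp_le {h : E → F} (hh : IsSmoothBounded h) (n : ℕ) :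
    ∃ Λ : ℝ, 0 ≤ Λ ∧ ∀ {f : F → G}, ContDiff ℝ ∞ f → ∀ {C : ℝ} (x : E),
      (∀ i ≤ n, ‖iteratedFDeriv ℝ i f (h x)‖ ≤ C) →
      ‖iteratedFDeriv ℝ n (fun y => f (h y)) x‖ ≤ Λ * C := by
  choose D hD using hh.bounded
  have hD0 : 0 ≤ ∑ i ∈ Finset.range (n + 1), |D i| := Finset.sum_nonneg fun i _ => abs_nonneg _
  refine ⟨n.factorial * (1 + ∑ i ∈ Finset.range (n + 1), |D i|) ^ n, by positivity,
    fun {f} hf {C} x hC => ?_⟩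
  rw [mul_right_comm]
  refine norm_iteratedFDeriv_comp_le hf hh.contDiff (natCast_le_infty n) x hC fun i hi1 hi => ?_
  have h1 : |D i| ≤ ∑ i ∈ Finset.range (n + 1), |D i| :=
    Finset.single_le_sum (fun i _ => abs_nonneg (D i)) (Finset.mem_range_succ_iff.2 hi)
  refine (((hD i x).trans (le_abs_self _)).trans ?_).trans
    (le_self_pow₀ ?_ (by omega : i ≠ 0))
  · linarith
  · linarith

lemma comp {f : F → G} (hf : ContDiff ℝ ∞ f) (hfb : DerivsBoundedOnBounded f) {h : E → F}
    (hh : IsSmoothBounded h) : IsSmoothBounded fun x => f (h x) := by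
  refine ⟨hf.comp hh.contDiff, fun n => ?_⟩
  have hb : Bornology.IsBounded (Set.range h) := by
    obtain ⟨D, hD⟩ := hh.bounded 0
    refine isBounded_iff_forall_norm_le.2 ⟨D, ?_⟩
    rintro _ ⟨x, rfl⟩
    simpa using hD x
  choose C hC using fun i => hfb i (Set.range h) hb
  obtain ⟨Λ, -, hΛ⟩ := hh.exists_norm_iteratedFDeriv_comp_le (G := G) n
  refine ⟨Λ * ∑ i ∈ Finset.range (n + 1), |C i|, fun x => hΛ hf x fun i hi => ?_⟩
  exact ((hC i _ ⟨x, rfl⟩).trans (le_abs_self _)).trans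
    (Finset.single_le_sum (fun i _ => abs_nonneg (C i)) (Finset.mem_range_succ_iff.2 hi))

end IsSmoothBounded

/-! ### Points where all derivatives vanish -/

lemma norm_iteratedFDeriv_iteratedFDeriv (f : E → F) (m n : ℕ) (x : E) :
    ‖iteratedFDeriv ℝ m (iteratedFDeriv ℝ n f) x‖ = ‖iteratedFDeriv ℝ (m + n) f x‖ := by
  induction n generalizing m with
  | zero =>
    rw [iteratedFDeriv_zero_eq_comp]
    exact LinearIsometryEquiv.norm_iteratedFDeriv_comp_left _ _ _ _
  | succ n ih =>
    have h := LinearIsometryEquiv.norm_iteratedFDeriv_comp_left (𝕜 := ℝ)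
      (F := E →L[ℝ] E [×n]→L[ℝ] F)
      (G := E [×n + 1]→L[ℝ] F)
      (continuousMultilinearCurryLeftEquiv ℝ (fun _ : Fin (n + 1) => E) F).symm
      (fderiv ℝ (iteratedFDeriv ℝ n f)) x m
    rw [iteratedFDeriv_succ_eq_comp_left]
    refine h.trans ?_
    rw [norm_iteratedFDeriv_fderiv, ih]
    rw [add_assoc, add_comm 1 n]

lemma IsSmoothBounded.iteratedFDeriv {f : E → F} (hf : IsSmoothBounded f) (n : ℕ) :
    IsSmoothBounded (iteratedFDeriv ℝ n f) := by
  refine ⟨hf.contDiff.iteratedFDeriv_right (by exact_mod_cast le_top), fun m => ?_⟩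
  obtain ⟨C, hC⟩ := hf.bounded (m + n)
  exact ⟨C, fun x => by rw [norm_iteratedFDeriv_iteratedFDeriv]; exact hC x⟩

lemma iteratedFDeriv_clm_apply_eq_zero {u : E → F →L[ℝ] G} {h : E → F} (hu : ContDiff ℝ ∞ u)
    (hh : ContDiff ℝ ∞ h) {x : E} (hx : ∀ m, iteratedFDeriv ℝ m u x = 0) (m : ℕ) :
    iteratedFDeriv ℝ m (fun y => u y (h y)) x = 0 := by
  refine norm_le_zero_iff.1 ((norm_iteratedFDeriv_clm_apply hu hh x (natCast_le_infty m)).trans ?_)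
  simp [hx]

lemma contDiff_clm_comp {f : E → F} (hf : ContDiff ℝ ∞ f) (L : F →L[ℝ] G) :
    ContDiff ℝ ∞ fun y => L (f y) :=
  L.contDiff.comp hf

lemma iteratedFDeriv_clm_comp_eq_zero {f : E → F} (hf : ContDiff ℝ ∞ f) (L : F →L[ℝ] G) {x : E}
    (hx : ∀ m, iteratedFDeriv ℝ m f x = 0) (m : ℕ) :
    iteratedFDeriv ℝ m (fun y => L (f y)) x = 0 := by
  refine norm_le_zero_iff.1 ((L.norm_iteratedFDeriv_comp_left hf.contDiffAt
    (natCast_le_infty m)).trans ?_)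
  simp [hx]

lemma iteratedFDeriv_apply_diag_eq_zero {n : ℕ}
    {u : E → ContinuousMultilinearMap ℝ (fun _ : Fin n => F) G} {h : E → F}
    (hu : ContDiff ℝ ∞ u) (hh : ContDiff ℝ ∞ h) {x : E}
    (hx : ∀ m, iteratedFDeriv ℝ m u x = 0) (m : ℕ) :
    iteratedFDeriv ℝ m (fun y => u y fun _ => h y) x = 0 := by
  induction n generalizing m with
  | zero =>
    have := iteratedFDeriv_clm_comp_eq_zero hu
      (continuousMultilinearCurryFin0 ℝ F G).toContinuousLinearEquiv.toContinuousLinearMap hx m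
    convert this using 3 with y
    exact congrArg (u y) (Subsingleton.elim _ _)
  | succ n ih =>
    let L := curryLeftCLM n F G
    have hLu : ContDiff ℝ ∞ fun y => L (u y) :=
      contDiff_clm_comp (G := F →L[ℝ] F [×n]→L[ℝ] G) hu L
    have h1 := iteratedFDeriv_clm_comp_eq_zero (G := F →L[ℝ] F [×n]→L[ℝ] G) hu L hx
    have h2 := iteratedFDeriv_clm_apply_eq_zero hLu hh h1
    have h3 := ih (hLu.clm_apply hh) h2 m
    simpa only [L, curryLeftCLM_apply_diag] using h3

/-! ### Flatness to infinite order at a point -/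

/-- `r` is flat at `y`: it vanishes there to infinite order. The condition concerns only the
values of `r`; for smooth `r` it implies that all derivatives vanish, see
`FlatAt.iteratedFDeriv_eq_zero`. -/
def FlatAt {E F : Type*} [NormedAddCommGroup E] [NormedAddCommGroup F] (r : E → F) (y : E) :
    Prop :=
  ∀ N : ℕ, r =O[𝓝 y] fun x => ‖x - y‖ ^ N

lemma flatAt_of_succ {E F : Type*} [NormedAddCommGroup E] [NormedAddCommGroup F] {r : E → F} {y : E}
    (h : ∀ N : ℕ, r =O[𝓝 y] fun x => ‖x - y‖ ^ (N + 1)) : FlatAt r y := by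
  intro N
  refine (h N).trans (IsBigO.of_bound 1 ?_)
  filter_upwards [Metric.ball_mem_nhds y one_pos] with x hx
  rw [Metric.mem_ball, dist_eq_norm] at hx
  rw [one_mul, norm_pow, norm_pow, norm_norm]
  exact pow_le_pow_of_le_one (norm_nonneg _) hx.le (Nat.le_succ N)

/-- Flatness passes to the derivative, by interpolation: a difference quotient of `r` at `x` with
step `s = ‖x - y‖ ^ (N + 1)` differs from the derivative by `O(s)`, and is itself
`O(‖x - y‖ ^ (2 * (N + 1)) / s)`. -/
lemma FlatAt.fderiv {r : E → F} {y : E} (hr : ContDiff ℝ ∞ r) (h : FlatAt r y) :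
    FlatAt (_root_.fderiv ℝ r) y := by
  refine flatAt_of_succ fun N => ?_
  have hy : _root_.fderiv ℝ r y = 0 := ((h 2).hasFDerivAt one_lt_two).fderiv
  obtain ⟨K, t, ht, hK⟩ := ((hr.fderiv_right (m := 1)
    (by rw [one_add_one_eq_two]; exact natCast_le_infty 2)).contDiffAt
      (x := y)).exists_lipschitzOnWith
  obtain ⟨C, hC0, hC⟩ := (h (2 * (N + 1))).exists_pos
  rw [IsBigOWith_def] at hC
  obtain ⟨ρ, hρ, hρt⟩ := Metric.mem_nhds_iff.1 (inter_mem ht hC)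
  refine IsBigO.of_bound (K + C * (4 ^ (N + 1) + 1)) ?_
  filter_upwards [Metric.ball_mem_nhds y (show 0 < min 1 (ρ / 2) by positivity)] with x hx
  rw [Metric.mem_ball, dist_eq_norm, lt_min_iff] at hx
  rw [norm_pow, norm_norm]
  rcases eq_or_ne x y with rfl | hxy
  · rw [hy, norm_zero]; positivity
  set d := ‖x - y‖ with hd
  have hd0 : 0 < d := norm_pos_iff.2 (sub_ne_zero.2 hxy)
  set s := d ^ (N + 1) with hs
  have hs0 : 0 < s := by positivity
  have hsd : s ≤ d := by
    simpa using pow_le_pow_of_le_one hd0.le hx.1.le (Nat.succ_le_succ (Nat.zero_le N))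
  have hball : Metric.closedBall x s ⊆ Metric.ball y ρ := fun z hz => by
    rw [Metric.mem_closedBall] at hz
    rw [Metric.mem_ball]
    have : dist x y = d := dist_eq_norm _ _
    linarith [dist_triangle z x y]
  have hrb : ∀ z ∈ Metric.closedBall x s, ‖r z‖ ≤ C * (2 * d) ^ (2 * (N + 1)) := fun z hz => by
    have h1 := (hρt (hball hz)).2
    simp only [Set.mem_ofPred_eq, norm_pow, norm_norm] at h1
    refine h1.trans ?_
    gcongr
    rw [Metric.mem_closedBall] at hz
    have : dist x y = d := dist_eq_norm _ _
    rw [← dist_eq_norm]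
    linarith [dist_triangle z x y]
  refine ContinuousLinearMap.opNorm_le_of_unit_norm (by positivity) fun v hv => ?_
  have hxs : x ∈ Metric.closedBall x s := Metric.mem_closedBall_self hs0.le
  have hvs : x + s • v ∈ Metric.closedBall x s := by
    rw [mem_closedBall_iff_norm, add_sub_cancel_left, norm_smul, hv, mul_one,
      Real.norm_of_nonneg hs0.le]
  have h1 := (convex_closedBall x s).norm_image_sub_le_of_norm_fderiv_le' (𝕜 := ℝ) (f := r)
    (φ := _root_.fderiv ℝ r x) (C := K * s)
    (fun z _ => (hr.differentiable (by simp)).differentiableAt) (fun z hz => by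
      refine (hK.norm_sub_le (hρt (hball hz)).1 (hρt (hball hxs)).1).trans ?_
      gcongr
      exact mem_closedBall_iff_norm.1 hz) hxs hvs
  rw [add_sub_cancel_left, map_smul, norm_smul, hv, mul_one, Real.norm_of_nonneg hs0.le] at h1
  have h2 : ‖s • _root_.fderiv ℝ r x v‖ ≤ K * s * s + C * (2 * d) ^ (2 * (N + 1)) +
      C * d ^ (2 * (N + 1)) := by
    have h3 : s • _root_.fderiv ℝ r x v = r (x + s • v) - r x -
      (r (x + s • v) - r x - s • _root_.fderiv ℝ r x v) := by abel
    have h4 : ‖r x‖ ≤ C * d ^ (2 * (N + 1)) := by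
      have h1 := (hρt (hball hxs)).2
      simpa only [Set.mem_ofPred_eq, norm_pow, norm_norm] using h1
    rw [h3]
    refine (norm_sub_le _ _).trans ?_
    have := norm_sub_le (r (x + s • v)) (r x)
    linarith [hrb _ hvs]
  rw [norm_smul, Real.norm_of_nonneg hs0.le] at h2
  have h5 : (2 * d) ^ (2 * (N + 1)) = 4 ^ (N + 1) * (s * s) := by
    rw [mul_pow, pow_mul 2 2, hs, ← pow_add]; norm_num; ring
  have h6 : d ^ (2 * (N + 1)) = s * s := by rw [hs, ← pow_add]; ring
  rw [h5, h6] at h2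
  refine le_of_mul_le_mul_left (h2.trans (le_of_eq ?_)) hs0
  ring

lemma FlatAt.iteratedFDeriv {r : E → F} {y : E} (hr : ContDiff ℝ ∞ r) (h : FlatAt r y) (m : ℕ) :
    FlatAt (_root_.iteratedFDeriv ℝ m r) y := by
  induction m with
  | zero =>
    intro N
    refine IsBigO.trans (IsBigO.of_norm_eventuallyLE (Eventually.of_forall fun x => ?_))
      (h N).norm_left
    simp
  | succ m ih =>
    intro N
    refine IsBigO.trans (IsBigO.of_norm_eventuallyLE (Eventually.of_forall fun x => ?_))
      ((ih.fderiv (hr.iteratedFDeriv_right (by exact_mod_cast le_top))) N).norm_left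
    rw [norm_fderiv_iteratedFDeriv]

lemma FlatAt.iteratedFDeriv_eq_zero {r : E → F} {y : E} (hr : ContDiff ℝ ∞ r) (h : FlatAt r y)
    (m : ℕ) : _root_.iteratedFDeriv ℝ m r y = 0 :=
  ((h.iteratedFDeriv hr m 1).eq_zero_of_norm_pow one_ne_zero)

/-! ### Taylor estimates -/

/-- Taylor's formula along a segment, with a non-optimal constant in the remainder. -/
lemma norm_sub_taylor_le {g : E → F} (hg : ContDiff ℝ ∞ g) (a h : E) (N : ℕ) {K : ℝ}
    (hK : ∀ t ∈ Set.Icc (0 : ℝ) 1, ‖iteratedFDeriv ℝ N g (a + t • h)‖ ≤ K) :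
    ‖g (a + h) - ∑ n ∈ Finset.range N, (n.factorial : ℝ)⁻¹ • iteratedFDeriv ℝ n g a fun _ => h‖ ≤
      K * ‖h‖ ^ N := by
  have hK0 : 0 ≤ K := (norm_nonneg _).trans (hK 0 (Set.left_mem_Icc.2 zero_le_one))
  rcases N with _ | n
  · simpa using hK 1 (Set.right_mem_Icc.2 zero_le_one)
  let L : ℝ →L[ℝ] E := ContinuousLinearMap.toSpanSingleton ℝ h
  let φ : ℝ → F := (fun y => g (a + y)) ∘ L
  have hg' : ContDiff ℝ ∞ fun y => g (a + y) := hg.comp (contDiff_const.add contDiff_id)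
  have hφ : ContDiff ℝ ∞ φ := hg'.comp L.contDiff
  have hd : ∀ k t, iteratedDeriv k φ t = iteratedFDeriv ℝ k g (a + t • h) fun _ => h := by
    intro k t
    rw [iteratedDeriv_eq_iteratedFDeriv, L.iteratedFDeriv_comp_right hg' t (natCast_le_infty k),
      iteratedFDeriv_comp_add_left]
    simp [L]
  have hdw : ∀ k, ∀ t ∈ Set.Icc (0 : ℝ) 1, iteratedDerivWithin k φ (Set.Icc 0 1) t =
      iteratedFDeriv ℝ k g (a + t • h) fun _ => h := fun k t ht => by
    rw [iteratedDerivWithin_eq_iteratedDeriv (uniqueDiffOn_Icc one_pos)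
      (hφ.of_le (natCast_le_infty k)).contDiffAt ht, hd]
  have := taylor_mean_remainder_bound (f := φ) (C := K * ‖h‖ ^ (n + 1)) (n := n)
    (zero_le_one (α := ℝ)) (hφ.of_le (natCast_le_infty (n + 1))).contDiffOn
    (Set.right_mem_Icc.2 zero_le_one) (fun t ht => by
      rw [hdw _ t ht]
      refine (ContinuousMultilinearMap.le_opNorm _ _).trans ?_
      rw [Finset.prod_const, Finset.card_univ, Fintype.card_fin]
      gcongr
      exact hK t ht)
  rw [taylor_within_apply] at this
  have h0 : (0 : ℝ) ∈ Set.Icc (0 : ℝ) 1 := Set.left_mem_Icc.2 zero_le_one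
  simp only [sub_zero, one_pow, mul_one, hdw _ 0 h0, zero_smul, add_zero] at this
  have hφ1 : φ 1 = g (a + h) := by simp [φ, L]
  rw [hφ1] at this
  refine this.trans (div_le_self (by positivity) ?_)
  exact_mod_cast Nat.one_le_iff_ne_zero.2 n.factorial_ne_zero

/-- If `P` is a projection and all derivatives of `g` vanish on the kernel of `P`, then the `m`-th
derivative at `x` is `O(‖P x‖ ^ N)`: apply the mean value inequality `N` times on segments from
`x - P x` to `x`. -/
lemma norm_iteratedFDeriv_le_of_vanish {g : E → F} (hg : ContDiff ℝ ∞ g) (P : E →L[ℝ] E)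
    (hP : ∀ x, P (P x) = P x) (h0 : ∀ x, P x = 0 → ∀ m, iteratedFDeriv ℝ m g x = 0)
    (N : ℕ) : ∀ (m : ℕ) {K : ℝ}, (∀ x, ‖iteratedFDeriv ℝ (m + N) g x‖ ≤ K) →
      ∀ x, ‖iteratedFDeriv ℝ m g x‖ ≤ K * ‖P x‖ ^ N := by
  induction N with
  | zero => intro m K hK x; simpa using hK x
  | succ N ih =>
    intro m K hK x
    have hK0 : 0 ≤ K := (norm_nonneg _).trans (hK x)
    have hPx : P (x - P x) = 0 := by rw [map_sub, hP, sub_self]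
    have h1 := (convex_segment (𝕜 := ℝ) (x - P x) x).norm_image_sub_le_of_norm_fderiv_le (𝕜 := ℝ)
      (f := iteratedFDeriv ℝ m g) (C := K * ‖P x‖ ^ N)
      (fun z _ => (hg.differentiable_iteratedFDeriv
        (by exact_mod_cast WithTop.coe_lt_top m)).differentiableAt)
      (fun z hz => by
        rw [norm_fderiv_iteratedFDeriv]
        refine (ih (m + 1) (fun x => by rw [show m + 1 + N = m + (N + 1) by ring]; exact hK x)
          z).trans ?_
        rw [segment_eq_image'] at hz
        obtain ⟨t, ht, rfl⟩ := hz
        gcongr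
        simp only [map_add, map_smul, map_sub, hP, sub_self, zero_add, sub_sub_cancel, norm_smul,
          Real.norm_of_nonneg ht.1]
        exact mul_le_of_le_one_left (norm_nonneg _) ht.2)
      (left_mem_segment ℝ _ _) (right_mem_segment ℝ _ _)
    rw [h0 _ hPx, sub_zero, sub_sub_cancel] at h1
    rw [pow_succ, ← mul_assoc]
    exact h1

end Calculus

/-! ### A Borel lemma with parameters -/

section Borel
variable {E X F : Type*} [NormedAddCommGroup E] [NormedSpace ℝ E]
  [NormedAddCommGroup X] [NormedSpace ℝ X] [NormedAddCommGroup F] [NormedSpace ℝ F]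

lemma IsSmoothBounded.rescale {H : X → X} (hH : IsSmoothBounded H) (c : ℝ) :
    IsSmoothBounded fun x => c⁻¹ • H (c • x) := by
  simpa using (hH.comp_clm (c • ContinuousLinearMap.id ℝ X)).clm_comp
    (c⁻¹ • ContinuousLinearMap.id ℝ X)

lemma eventually_rescale_eq {H : X → X} (hH : ∀ᶠ x in 𝓝 (0 : X), H x = x) {c : ℝ} (hc : c ≠ 0) :
    ∀ᶠ x in 𝓝 (0 : X), c⁻¹ • H (c • x) = x := by
  have : Tendsto (fun x : X => c • x) (𝓝 0) (𝓝 0) := by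
    simpa using (continuous_const_smul c).tendsto (0 : X)
  filter_upwards [this.eventually hH] with x hx
  rw [hx, inv_smul_smul₀ hc]

/-- The `n`-th term of the Borel series: the homogeneous polynomial `u x (P x, …, P x)` in which
`P x` is cut off by the rescaled map `y ↦ c⁻¹ H (c y)`. -/
noncomputable def borelTerm {n : ℕ} (H : X → X) (P : E →L[ℝ] X)
    (u : E → X [×n]→L[ℝ] F) (c : ℝ) (x : E) : F :=
  u x fun _ => c⁻¹ • H (c • P x)

lemma isSmoothBounded_borelTerm {n : ℕ} {H : X → X} (hH : IsSmoothBounded H) (P : E →L[ℝ] X)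
    {u : E → X [×n]→L[ℝ] F} (hu : IsSmoothBounded u) (c : ℝ) :
    IsSmoothBounded (borelTerm H P u c) :=
  hu.apply_diag ((hH.rescale c).comp_clm P)

/-- Derivatives of order `k < n` of the `n`-th term are `O(1 / c)`: the term is `c ^ (-n)` times a
fixed bounded smooth map evaluated at `(x, c P x)`, and each derivative costs at most one factor
of order `c`. -/
lemma exists_iteratedFDeriv_borelTerm_le {n : ℕ} {H : X → X} (hH : IsSmoothBounded H)
    (P : E →L[ℝ] X) {u : E → X [×n]→L[ℝ] F} (hu : IsSmoothBounded u) {k : ℕ} (hk : k < n) :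
    ∃ K : ℝ, 0 ≤ K ∧ ∀ c : ℝ, 1 ≤ c → ∀ x, ‖iteratedFDeriv ℝ k (borelTerm H P u c) x‖ ≤ K / c := by
  let V : E × X → F := fun p => u p.1 fun _ => H p.2
  have hV : IsSmoothBounded V := (hu.comp_clm (ContinuousLinearMap.fst ℝ E X)).apply_diag
    (hH.comp_clm (ContinuousLinearMap.snd ℝ E X))
  obtain ⟨B, hB⟩ := hV.bounded k
  have hB0 : 0 ≤ B := (norm_nonneg _).trans (hB 0)
  refine ⟨B * (1 + ‖P‖) ^ k, by positivity, fun c hc x => ?_⟩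
  have hc0 : 0 < c := one_pos.trans_le hc
  let L : E →L[ℝ] E × X := (ContinuousLinearMap.id ℝ E).prod (c • P)
  have hL : ‖L‖ ≤ c * (1 + ‖P‖) := by
    refine ContinuousLinearMap.opNorm_le_bound _ (by positivity) fun y => ?_
    have h1 : ‖P y‖ ≤ ‖P‖ * ‖y‖ := P.le_opNorm y
    refine max_le ?_ ?_
    · change ‖y‖ ≤ _
      nlinarith [norm_nonneg y, norm_nonneg P, mul_nonneg (norm_nonneg P) (norm_nonneg y)]
    · change ‖c • P y‖ ≤ _
      rw [norm_smul, Real.norm_of_nonneg hc0.le]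
      nlinarith [norm_nonneg y, norm_nonneg P]
  have hVL : ContDiff ℝ ∞ fun y => V (L y) := (hV.comp_clm L).contDiff
  have heq : borelTerm H P u c = fun y => ((c⁻¹) ^ n • ContinuousLinearMap.id ℝ F) (V (L y)) := by
    funext y
    simp [borelTerm, V, L, ContinuousMultilinearMap.map_smul_univ]
  rw [heq]
  refine (ContinuousLinearMap.norm_iteratedFDeriv_comp_left _ hVL.contDiffAt
    (natCast_le_infty k)).trans ?_
  have h1 : ‖(c⁻¹) ^ n • ContinuousLinearMap.id ℝ F‖ ≤ (c⁻¹) ^ n := by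
    rw [norm_smul, Real.norm_of_nonneg (by positivity)]
    exact mul_le_of_le_one_right (by positivity) ContinuousLinearMap.norm_id_le
  have h2 := (norm_iteratedFDeriv_comp_clm_le hV.contDiff L k x).trans
    (mul_le_mul (hB _) (pow_le_pow_left₀ (norm_nonneg _) hL k) (by positivity) hB0)
  refine (mul_le_mul h1 h2 (norm_nonneg _) (by positivity)).trans ?_
  have h3 : (c⁻¹) ^ n * c ^ k ≤ c⁻¹ := by
    obtain ⟨j, rfl⟩ := Nat.exists_eq_add_of_lt hk
    rw [show k + j + 1 = k + (j + 1) by ring, pow_add, mul_right_comm, ← mul_pow,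
      inv_mul_cancel₀ hc0.ne', one_pow, one_mul]
    exact pow_le_of_le_one (by positivity) (inv_le_one_of_one_le₀ hc) (Nat.succ_ne_zero j)
  calc (c⁻¹) ^ n * (B * (c * (1 + ‖P‖)) ^ k)
      = (B * (1 + ‖P‖) ^ k) * ((c⁻¹) ^ n * c ^ k) := by rw [mul_pow]; ring
    _ ≤ _ := by rw [div_eq_mul_inv]; gcongr

lemma IsSmoothBounded.exists_norm_sub_le {f : E → F} (hf : IsSmoothBounded f) :
    ∃ L : ℝ, ∀ x y, ‖f x - f y‖ ≤ L * ‖x - y‖ := by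
  obtain ⟨L, hL⟩ := hf.bounded 1
  refine ⟨L, fun x y => convex_univ.norm_image_sub_le_of_norm_fderiv_le (𝕜 := ℝ)
    (fun z _ => (hf.contDiff.differentiable (by simp)).differentiableAt)
    (fun z _ => ?_) (Set.mem_univ y) (Set.mem_univ x)⟩
  rw [← norm_iteratedFDeriv_one]; exact hL z

/-- The `n`-th term is `O(‖P x‖ ^ N / c)` for `N < n`: of the `n` arguments `c⁻¹ H (c P x)`, bound
`N` by a multiple of `‖P x‖` and the others by a multiple of `c⁻¹`. -/
lemma exists_norm_borelTerm_le {n : ℕ} {H : X → X} (hH : IsSmoothBounded H) (hH0 : H 0 = 0)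
    (P : E →L[ℝ] X) {u : E → X [×n]→L[ℝ] F} (hu : IsSmoothBounded u) :
    ∃ K : ℝ, 0 ≤ K ∧ ∀ c : ℝ, 1 ≤ c → ∀ N < n, ∀ x, ‖borelTerm H P u c x‖ ≤ K / c * ‖P x‖ ^ N := by
  obtain ⟨U, hU⟩ := hu.bounded 0
  obtain ⟨B, hB⟩ := hH.bounded 0
  obtain ⟨L, hL⟩ := hH.exists_norm_sub_le
  simp only [norm_iteratedFDeriv_zero] at hU hB
  set M := max 1 (max B L) with hM
  have hM1 : 1 ≤ M := le_max_left _ _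
  have hM0 : 0 ≤ M := zero_le_one.trans hM1
  have hMB : B ≤ M := (le_max_left _ _).trans (le_max_right _ _)
  have hML : L ≤ M := (le_max_right _ _).trans (le_max_right _ _)
  refine ⟨|U| * M ^ n, by positivity, fun c hc N hN x => ?_⟩
  have hc0 : 0 < c := one_pos.trans_le hc
  set w := c⁻¹ • H (c • P x) with hw
  have h1 : ‖w‖ ≤ M * ‖P x‖ := by
    have := hL (c • P x) 0
    rw [hH0, sub_zero, sub_zero, norm_smul, Real.norm_of_nonneg hc0.le] at this
    rw [hw, norm_smul, norm_inv, Real.norm_of_nonneg hc0.le, inv_mul_le_iff₀ hc0]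
    refine this.trans ?_
    rw [← mul_assoc, ← mul_assoc, mul_comm c M]
    gcongr
  have h2 : ‖w‖ ≤ M * c⁻¹ := by
    rw [hw, norm_smul, norm_inv, Real.norm_of_nonneg hc0.le, mul_comm]
    gcongr
    exact (hB _).trans hMB
  obtain ⟨j, rfl⟩ := Nat.exists_eq_add_of_lt hN
  have h3 : (c⁻¹) ^ (j + 1) ≤ c⁻¹ :=
    pow_le_of_le_one (by positivity) (inv_le_one_of_one_le₀ hc) (Nat.succ_ne_zero j)
  calc ‖borelTerm H P u c x‖ ≤ ‖u x‖ * ‖w‖ ^ (N + j + 1) := by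
        refine (ContinuousMultilinearMap.le_opNorm _ _).trans (le_of_eq ?_)
        rw [Finset.prod_const, Finset.card_univ, Fintype.card_fin]
    _ = ‖u x‖ * (‖w‖ ^ N * ‖w‖ ^ (j + 1)) := by ring
    _ ≤ |U| * ((M * ‖P x‖) ^ N * (M * c⁻¹) ^ (j + 1)) := by
        gcongr
        exact (hU x).trans (le_abs_self U)
    _ = |U| * M ^ (N + j + 1) * (c⁻¹) ^ (j + 1) * ‖P x‖ ^ N := by rw [mul_pow, mul_pow]; ring
    _ ≤ |U| * M ^ (N + j + 1) * c⁻¹ * ‖P x‖ ^ N := by gcongr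

/-- The scale `c` is chosen so large that the bounds `O(1 / c)` of `exists_iteratedFDeriv_borelTerm_le`
and `exists_norm_borelTerm_le` become `(1 / 2) ^ n`, which is summable in `n`. -/
lemma exists_scale {n : ℕ} {H : X → X} (hH : IsSmoothBounded H) (hH0 : H 0 = 0)
    (P : E →L[ℝ] X) {u : E → X [×n]→L[ℝ] F} (hu : IsSmoothBounded u) :
    ∃ c : ℝ, 1 ≤ c ∧
      (∀ k < n, ∀ x, ‖iteratedFDeriv ℝ k (borelTerm H P u c) x‖ ≤ (1 / 2) ^ n) ∧
      ∀ N < n, ∀ x, ‖borelTerm H P u c x‖ ≤ (1 / 2) ^ n * ‖P x‖ ^ N := by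
  have h1 : ∀ k : ℕ, ∃ K : ℝ, 0 ≤ K ∧ (k < n → ∀ c : ℝ, 1 ≤ c → ∀ x,
      ‖iteratedFDeriv ℝ k (borelTerm H P u c) x‖ ≤ K / c) := fun k => by
    by_cases hk : k < n
    · obtain ⟨K, hK0, hK⟩ := exists_iteratedFDeriv_borelTerm_le hH P hu hk
      exact ⟨K, hK0, fun _ => hK⟩
    · exact ⟨0, le_rfl, fun h => absurd h hk⟩
  choose K hK0 hK using h1
  obtain ⟨K', hK'0, hK'⟩ := exists_norm_borelTerm_le hH hH0 P hu
  set S := ∑ k ∈ Finset.range n, K k with hS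
  have hS0 : 0 ≤ S := Finset.sum_nonneg fun k _ => hK0 k
  set c := 1 + 2 ^ n * (S + K') with hc
  have hc1 : 1 ≤ c := by
    have : 0 ≤ 2 ^ n * (S + K') := by positivity
    linarith
  have hc0 : 0 < c := one_pos.trans_le hc1
  have hdiv : ∀ a, a ≤ S + K' → a / c ≤ (1 / 2) ^ n := fun a ha => by
    rw [div_le_iff₀ hc0, one_div, inv_pow, ← div_eq_inv_mul, le_div_iff₀ (by positivity)]
    nlinarith [pow_pos (two_pos (α := ℝ)) n]
  refine ⟨c, hc1, fun k hk x => (hK k hk c hc1 x).trans (hdiv _ ?_), fun N hN x =>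
    (hK' c hc1 N hN x).trans ?_⟩
  · have := Finset.single_le_sum (fun k _ => hK0 k) (Finset.mem_range.2 hk)
    linarith
  · gcongr
    exact hdiv _ (by linarith)

/-- **Borel lemma with parameters.** Given bounded smooth coefficients `u n`, there is a bounded
smooth `T` with the asymptotic expansion `T x ∼ ∑ u n x (P x, …, P x)` as `P x → 0`, uniformly in
`x`. Moreover `T` has vanishing derivatives wherever all the coefficients do. -/
theorem exists_borel_sum [CompleteSpace F] {H : X → X} (hH : IsSmoothBounded H)
    (hHid : ∀ᶠ x in 𝓝 (0 : X), H x = x) (P : E →L[ℝ] X) {u : ∀ n : ℕ, E → X [×n]→L[ℝ] F}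
    (hu : ∀ n, IsSmoothBounded (u n)) :
    ∃ T : E → F, IsSmoothBounded T ∧
      (∀ N : ℕ, ∃ C : ℝ, ∀ᶠ y in 𝓝 (0 : X), ∀ x, P x = y →
        ‖T x - ∑ n ∈ Finset.range N, u n x fun _ => P x‖ ≤ C * ‖P x‖ ^ N) ∧
      ∀ x, (∀ n m, iteratedFDeriv ℝ m (u n) x = 0) → ∀ m, iteratedFDeriv ℝ m T x = 0 := by
  have hH0 : H 0 = 0 := hHid.self_of_nhds
  choose c hc1 hcd hcN using fun n => exists_scale hH hH0 P (hu n)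
  set t : ℕ → E → F := fun n => borelTerm H P (u n) (c n) with ht
  have htS : ∀ n, IsSmoothBounded (t n) := fun n => isSmoothBounded_borelTerm hH P (hu n) (c n)
  choose B hB using fun n => (htS n).bounded
  -- for fixed `k`, the geometric bound holds for all but the first `k + 1` terms
  let v : ℕ → ℕ → ℝ := fun k n => if k < n then (1 / 2) ^ n else B n k
  have hv : ∀ k, Summable (v k) := fun k => by
    refine (summable_geometric_of_lt_one (r := (1 / 2 : ℝ)) (by norm_num)
      (by norm_num)).congr_cofinite ?_
    rw [Nat.cofinite_eq_atTop]
    filter_upwards [eventually_gt_atTop k] with n hn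
    simp [v, hn]
  have htv : ∀ k n x, ‖iteratedFDeriv ℝ k (t n) x‖ ≤ v k n := fun k n x => by
    by_cases hk : k < n
    · simpa [v, hk] using hcd n k hk x
    · simpa [v, hk] using hB n k x
  have htc : ∀ n, ContDiff ℝ ((⊤ : ℕ∞) : WithTop ℕ∞) (t n) := fun n => (htS n).contDiff
  have hsum : ∀ x, Summable fun n => t n x := fun x =>
    .of_norm_bounded (hv 0) fun n => by simpa using htv 0 n x
  have hTd : ∀ k x, iteratedFDeriv ℝ k (fun x => ∑' n, t n x) x =
      ∑' n, iteratedFDeriv ℝ k (t n) x := fun k x =>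
    iteratedFDeriv_tsum_apply htc (fun k _ => hv k) (fun k n x _ => htv k n x) le_top x
  refine ⟨fun x => ∑' n, t n x, ⟨?_, fun k => ⟨∑' n, v k n, fun x => ?_⟩⟩, fun N => ?_,
    fun x hx m => ?_⟩
  · exact contDiff_tsum htc (fun k _ => hv k) (fun k n x _ => htv k n x)
  · rw [hTd]
    exact tsum_of_norm_bounded (hv k).hasSum fun n => htv k n x
  · obtain ⟨U, hU⟩ := (hu N).bounded 0
    refine ⟨U + 2, ?_⟩
    have hev : ∀ᶠ y in 𝓝 (0 : X), ∀ n ∈ Finset.range (N + 1), (c n)⁻¹ • H (c n • y) = y := by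
      rw [eventually_all_finset]
      exact fun n _ => eventually_rescale_eq hHid (one_pos.trans_le (hc1 n)).ne'
    filter_upwards [hev] with y hy x hxy
    have h1 : ∀ n ∈ Finset.range (N + 1), t n x = u n x fun _ => P x := fun n hn => by
      simp only [ht, borelTerm, hxy, hy n hn]
    have h2 : (∑' n, t n x) - ∑ n ∈ Finset.range N, u n x (fun _ => P x) =
        u N x (fun _ => P x) + ∑' n, t (n + (N + 1)) x := by
      rw [← (hsum x).sum_add_tsum_nat_add (N + 1), Finset.sum_congr rfl h1,
        Finset.sum_range_succ]
      abel
    have h3 : ‖u N x fun _ => P x‖ ≤ U * ‖P x‖ ^ N := by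
      refine (ContinuousMultilinearMap.le_opNorm _ _).trans ?_
      rw [Finset.prod_const, Finset.card_univ, Fintype.card_fin]
      gcongr
      simpa using hU x
    have h4 : ‖∑' n, t (n + (N + 1)) x‖ ≤ 2 * ‖P x‖ ^ N := by
      refine tsum_of_norm_bounded (hasSum_geometric_two.mul_right (‖P x‖ ^ N)) fun n => ?_
      refine (hcN (n + (N + 1)) N (by omega) x).trans ?_
      gcongr ?_ * _
      exact pow_le_pow_of_le_one (by norm_num) (by norm_num) (by omega)
    rw [h2, add_mul]
    exact (norm_add_le _ _).trans (add_le_add h3 h4)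
  · rw [hTd]
    have : ∀ n, iteratedFDeriv ℝ m (t n) x = 0 := fun n =>
      iteratedFDeriv_apply_diag_eq_zero (hu n).contDiff
        ((hH.rescale (c n)).comp_clm P).contDiff (hx n) m
    simp [this]

end Borel

/-! ### Solving the equation by a telescoping series -/

section Solve
variable {X F : Type*} [NormedAddCommGroup X] [NormedSpace ℝ X]
  [NormedAddCommGroup F] [NormedSpace ℝ F]

/-- `g` is flat along the kernel of `P`: every derivative of `g` is `O(‖P x‖ ^ N)` for all `N`,
uniformly over the points `x` with `P x` small. -/
def IsFlatAlong (P : X →L[ℝ] X) (g : X → F) : Prop :=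
  ∀ m N : ℕ, ∃ C δ : ℝ, 0 < δ ∧ ∀ x, ‖P x‖ < δ → ‖iteratedFDeriv ℝ m g x‖ ≤ C * ‖P x‖ ^ N

lemma exists_pow_mul_le_half {q : ℝ} (hq0 : 0 < q) (hq1 : q < 1) (a : ℝ) :
    ∃ N : ℕ, 1 ≤ N ∧ q ^ N * a ≤ 1 / 2 := by
  have h : Tendsto (fun N : ℕ => q ^ N * a) atTop (𝓝 0) := by
    simpa using (tendsto_pow_atTop_nhds_zero_of_lt_one hq0.le hq1).mul_const a
  obtain ⟨N, h1, h2⟩ := ((h.eventually_le_const (show (0 : ℝ) < 1 / 2 by norm_num)).and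
    (eventually_ge_atTop 1)).exists
  exact ⟨N, h2, h1⟩

/-- If `P A^k x` decays like `q ^ k`, then flatness of large order `N` beats the growth
`‖A‖ ^ (k * m)` of the `m`-th derivative of `A^k`, so the derivatives of `g ∘ A^k` decay geometrically on
balls. -/
lemma exists_iteratedFDeriv_comp_iterate_le {A P : X →L[ℝ] X} {C q : ℝ} (hq0 : 0 < q) (hq1 : q < 1)
    (hdecay : ∀ (k : ℕ) x, ‖P ((A : X → X)^[k] x)‖ ≤ C * q ^ k * ‖x‖)
    {g : X → F} (hg : ContDiff ℝ ∞ g) (hflat : IsFlatAlong P g) (m : ℕ) (ρ : ℝ) :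
    ∃ K : ℝ, 0 ≤ K ∧ ∀ᶠ k : ℕ in atTop, ∀ x, ‖x‖ ≤ ρ →
      ‖iteratedFDeriv ℝ m (fun y => g ((A : X → X)^[k] y)) x‖ ≤ K * (1 / 2) ^ k := by
  obtain ⟨N, hN1, hN⟩ := exists_pow_mul_le_half hq0 hq1 (‖A‖ ^ m)
  obtain ⟨D, δ, hδ, hD⟩ := hflat m N
  refine ⟨|D| * (|C| * |ρ|) ^ N, by positivity, ?_⟩
  have hlim : Tendsto (fun k : ℕ => |C| * |ρ| * q ^ k) atTop (𝓝 0) := by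
    simpa using (tendsto_pow_atTop_nhds_zero_of_lt_one hq0.le hq1).const_mul (|C| * |ρ|)
  filter_upwards [hlim.eventually_lt_const hδ] with k hk x hx
  have h1 : ‖P ((A : X → X)^[k] x)‖ ≤ |C| * |ρ| * q ^ k := by
    refine (hdecay k x).trans ?_
    rw [mul_right_comm]
    gcongr
    exacts [le_abs_self C, hx.trans (le_abs_self ρ)]
  have hiter : ∀ y, (A : X → X)^[k] y = (A ^ k) y := fun y => by simp
  have h2 : ‖iteratedFDeriv ℝ m g ((A ^ k) x)‖ ≤ |D| * (|C| * |ρ| * q ^ k) ^ N := by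
    rw [← hiter]
    refine (hD _ (h1.trans_lt hk)).trans ?_
    gcongr
    exact le_abs_self D
  simp only [hiter]
  refine (norm_iteratedFDeriv_comp_clm_le hg (A ^ k) m x).trans ?_
  have h3 : ‖A ^ k‖ ≤ ‖A‖ ^ k := by
    rcases k with _ | k
    · rw [pow_zero, pow_zero]
      exact ContinuousLinearMap.norm_id_le
    · exact norm_pow_le' A k.succ_pos
  calc _ ≤ |D| * (|C| * |ρ| * q ^ k) ^ N * (‖A‖ ^ k) ^ m := by gcongr
    _ = |D| * (|C| * |ρ|) ^ N * (q ^ N * ‖A‖ ^ m) ^ k := by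
        rw [mul_pow (|C| * |ρ|), mul_pow (q ^ N), ← pow_mul, ← pow_mul, ← pow_mul, ← pow_mul,
          mul_comm k N, mul_comm k m]
        ring
    _ ≤ _ := by gcongr

/-- If `g` is flat along the kernel of `P` and the orbits of `A` approach this kernel geometrically,
then `h = -∑ g ∘ A^k` is a smooth solution of `h ∘ A - h = g`. -/
theorem exists_solution_of_isFlatAlong [CompleteSpace F] {H : X → X} (hH : IsSmoothBounded H)
    (hHid : ∀ᶠ x in 𝓝 (0 : X), H x = x) {A P : X →L[ℝ] X} {C q : ℝ} (hq0 : 0 < q) (hq1 : q < 1)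
    (hdecay : ∀ (k : ℕ) x, ‖P ((A : X → X)^[k] x)‖ ≤ C * q ^ k * ‖x‖)
    {g : X → F} (hg : ContDiff ℝ ∞ g) (hflat : IsFlatAlong P g) :
    ∃ h : X → F, ContDiff ℝ ∞ h ∧ ∀ x, h (A x) - h x = g x := by
  set Φ : ℕ → X → F := fun k y => g ((A : X → X)^[k] y) with hΦ
  have hΦc : ∀ k, ContDiff ℝ ∞ (Φ k) := fun k => by
    have : Φ k = fun y => g ((A ^ k) y) := by funext y; simp [hΦ]
    rw [this]
    exact hg.comp (A ^ k).contDiff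
  have hsum : ∀ x, Summable fun k => Φ k x := fun x => by
    obtain ⟨K, hK0, hK⟩ := exists_iteratedFDeriv_comp_iterate_le hq0 hq1 hdecay hg hflat 0 ‖x‖
    refine .of_norm_bounded_eventually_nat ((summable_geometric_of_lt_one (r := (1 / 2 : ℝ))
      (by norm_num) (by norm_num)).mul_left K) ?_
    filter_upwards [hK] with k hk
    simpa using hk x le_rfl
  refine ⟨fun x => -∑' k, Φ k x, ?_, fun x => ?_⟩
  · refine (contDiff_iff_contDiffAt.2 fun x => ?_ : ContDiff ℝ ∞ fun x => ∑' k, Φ k x).neg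
    obtain ⟨ε, hε, hεH⟩ := Metric.eventually_nhds_iff.1 hHid
    -- The series converges well only on bounded sets. Near `x` it coincides with its composition
    -- with the bounded map `Θ = c⁻¹ H (c ·)`, where `c` is so small that `Θ` is the identity near
    -- `x`.
    set c : ℝ := ε / (2 * (‖x‖ + 1)) with hc
    have hc0 : 0 < c := by positivity
    have hΘ := hH.rescale c
    set Θ : X → X := fun x => c⁻¹ • H (c • x) with hΘdef
    choose D hD using hΘ.bounded
    have hΘb : ∀ y, ‖Θ y‖ ≤ D 0 := fun y => by simpa using hD 0 y
    have hΘid : ∀ᶠ y in 𝓝 x, Θ y = y := by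
      filter_upwards [Metric.ball_mem_nhds x one_pos] with y hy
      have : ‖y‖ < ‖x‖ + 1 := by
        have := norm_sub_norm_le y x
        rw [Metric.mem_ball, dist_eq_norm] at hy
        linarith
      rw [hΘdef]
      have h1 : H (c • y) = c • y := hεH (by
        rw [dist_zero_right, norm_smul, Real.norm_of_nonneg hc0.le, hc, div_mul_eq_mul_div,
          div_lt_iff₀ (by positivity)]
        nlinarith [norm_nonneg x])
      simp only [h1, inv_smul_smul₀ hc0.ne']
    have hcomp : ContDiff ℝ ((⊤ : ℕ∞) : WithTop ℕ∞) fun y => ∑' k, Φ k (Θ y) := by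
      choose K hK0 hK using fun m =>
        exists_iteratedFDeriv_comp_iterate_le hq0 hq1 hdecay hg hflat m (D 0)
      choose Λ hΛ0 hΛ using hΘ.exists_norm_iteratedFDeriv_comp_le (G := F)
      refine contDiff_tsum_of_eventually (v := fun m k => Λ m *
        ((∑ i ∈ Finset.range (m + 1), K i) * (1 / 2) ^ k)) (fun k => (hΦc k).comp hΘ.contDiff)
        (fun m _ => ?_) fun m _ => ?_
      · exact ((summable_geometric_of_lt_one (r := (1 / 2 : ℝ)) (by norm_num)
          (by norm_num)).mul_left _).mul_left _
      · rw [Nat.cofinite_eq_atTop]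
        have hev : ∀ᶠ k : ℕ in atTop, ∀ i ∈ Finset.range (m + 1), ∀ x, ‖x‖ ≤ D 0 →
            ‖iteratedFDeriv ℝ i (Φ k) x‖ ≤ K i * (1 / 2) ^ k := by
          rw [eventually_all_finset]
          exact fun i _ => hK i
        filter_upwards [hev] with k hk y
        refine hΛ m (hΦc k) y fun i hi => ?_
        refine (hk i (Finset.mem_range_succ_iff.2 hi) _ (hΘb y)).trans ?_
        gcongr
        exact Finset.single_le_sum (fun i _ => hK0 i) (Finset.mem_range_succ_iff.2 hi)
    refine hcomp.contDiffAt.congr_of_eventuallyEq ?_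
    filter_upwards [hΘid] with y hy
    rw [hy]
  · have h1 := (hsum x).tsum_eq_zero_add
    have h2 : ∀ k, Φ (k + 1) x = Φ k (A x) := fun k => by
      simp only [hΦ, Function.iterate_succ_apply]
    simp only [h2] at h1
    have h3 : Φ 0 x = g x := rfl
    beta_reduce
    rw [h1, h3]
    abel

end Solve

/-! ### Flat right-hand sides and the formal correction -/

section Main
variable {X F : Type*} [NormedAddCommGroup X] [NormedSpace ℝ X]
  [NormedAddCommGroup F] [NormedSpace ℝ F]

lemma DerivsBoundedOnBounded.sub {f g : X → F} (hf : ContDiff ℝ ∞ f)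
    (hfb : DerivsBoundedOnBounded f) (hg : IsSmoothBounded g) :
    DerivsBoundedOnBounded fun x => f x - g x := by
  intro n S hS
  obtain ⟨C, hC⟩ := hfb n S hS
  obtain ⟨D, hD⟩ := hg.bounded n
  refine ⟨C + D, fun x hx => ?_⟩
  rw [fun_iteratedFDeriv_sub_apply (hf.of_le (natCast_le_infty n)).contDiffAt
    (hg.contDiff.of_le (natCast_le_infty n)).contDiffAt]
  exact (norm_sub_le _ _).trans (add_le_add (hC x hx) (hD x))

lemma flatAt_of_norm_le_pow {F : Type*} [NormedAddCommGroup F] {r : X → F}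
    {P : X →L[ℝ] X} {x₀ : X} (hx₀ : P x₀ = 0)
    (h : ∀ N : ℕ, ∃ C : ℝ, ∀ᶠ x in 𝓝 x₀, ‖r x‖ ≤ C * ‖P x‖ ^ N) : FlatAt r x₀ := by
  intro N
  obtain ⟨C, hC⟩ := h N
  refine IsBigO.of_bound (|C| * ‖P‖ ^ N) ?_
  filter_upwards [hC] with x hx
  rw [norm_pow, norm_norm, mul_assoc, ← mul_pow]
  refine hx.trans ?_
  have : ‖P x‖ ≤ ‖P‖ * ‖x - x₀‖ := by
    simpa [hx₀] using P.le_opNorm (x - x₀)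
  gcongr
  exact le_abs_self C

lemma isFlatAlong_of_vanish {g : X → F} (hg : IsSmoothBounded g) {P : X →L[ℝ] X}
    (hP : ∀ x, P (P x) = P x) (h0 : ∀ x, P x = 0 → ∀ m, iteratedFDeriv ℝ m g x = 0) :
    IsFlatAlong P g := by
  intro m N
  obtain ⟨K, hK⟩ := hg.bounded (m + N)
  exact ⟨K, 1, one_pos, fun x _ =>
    norm_iteratedFDeriv_le_of_vanish hg.contDiff P hP h0 N m hK x⟩

lemma isFlatAlong_of_eq_zero {g : X → F} {P : X →L[ℝ] X}
    (h : ∀ᶠ y in 𝓝 (0 : X), ∀ x, P x = y → g x = 0) : IsFlatAlong P g := by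
  intro m N
  obtain ⟨δ, hδ, hδg⟩ := Metric.eventually_nhds_iff.1 h
  refine ⟨0, δ, hδ, fun x hx => ?_⟩
  have h1 : g =ᶠ[𝓝 x] fun _ => 0 := by
    filter_upwards [P.continuous.norm.continuousAt.eventually_lt continuousAt_const hx] with y hy
    exact hδg (by rwa [dist_zero_right]) y rfl
  rw [(h1.iteratedFDeriv ℝ m).self_of_nhds]
  simp

/-- A function that is flat at the origin is a sum of functions flat along `ker P` and functions
flat along `ker Q`, for complementary projections `P` and `Q`. Applying `H` to the `P`-component
and then to the `Q`-component changes `f` by functions vanishing near `ker P` and near `ker Q`.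
This leaves a function `g` with bounded derivatives, from which one subtracts the Borel sum `T` of
its Taylor series along `ker P`. The difference is flat along `ker P`, while `T` is flat along
`ker Q` because its coefficients are derivatives of `g` at points `Q x` and `g` is flat at the
origin. -/
theorem exists_isFlatAlong_add [CompleteSpace F] {H : X → X} (hH : IsSmoothBounded H)
    (hHid : ∀ᶠ x in 𝓝 (0 : X), H x = x) {P Q : X →L[ℝ] X} (hP : ∀ x, P (P x) = P x)
    (hPQ : ∀ x, Q x + P x = x) {f : X → F} (hf : ContDiff ℝ ∞ f) (hfb : DerivsBoundedOnBounded f)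
    (hf0 : ∀ m, iteratedFDeriv ℝ m f 0 = 0) :
    ∃ f₁ f₂ f₃ f₄ : X → F, ContDiff ℝ ∞ f₁ ∧ ContDiff ℝ ∞ f₂ ∧ ContDiff ℝ ∞ f₃ ∧ ContDiff ℝ ∞ f₄ ∧
      IsFlatAlong P f₁ ∧ IsFlatAlong Q f₂ ∧ IsFlatAlong P f₃ ∧ IsFlatAlong Q f₄ ∧
      ∀ x, f x = f₁ x + f₂ x + f₃ x + f₄ x := by
  have hQ' : ∀ x, Q x = x - P x := fun x => eq_sub_of_add_eq (hPQ x)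
  have hQ : ∀ x, Q (Q x) = Q x := fun x => by rw [hQ' (Q x), hQ' x, map_sub, hP]; simp
  let Φ : X → X := fun x => Q x + P (H (P x))
  let Ψ : X → X := fun x => Q (H (Q x)) + P (H (P x))
  have hΨ : IsSmoothBounded Ψ :=
    ((hH.comp_clm Q).clm_comp Q).add ((hH.comp_clm P).clm_comp P)
  have hΦ : ContDiff ℝ ∞ Φ := Q.contDiff.add ((hH.comp_clm P).clm_comp P).contDiff
  have hF : IsSmoothBounded fun x => f (Ψ x) := IsSmoothBounded.comp hf hfb hΨ
  set g : X → F := fun x => f (Ψ x) with hg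
  have hΨid : ∀ᶠ x in 𝓝 (0 : X), Ψ x = x := by
    have h1 : Tendsto Q (𝓝 0) (𝓝 0) := by simpa using Q.continuous.tendsto 0
    have h2 : Tendsto P (𝓝 0) (𝓝 0) := by simpa using P.continuous.tendsto 0
    filter_upwards [h1.eventually hHid, h2.eventually hHid] with x hx1 hx2
    simp only [Ψ, hx1, hx2, hP, hQ, hPQ]
  have hg0 : ∀ m, iteratedFDeriv ℝ m g 0 = 0 := fun m => by
    have h1 : g =ᶠ[𝓝 0] f := by
      filter_upwards [hΨid] with x hx
      rw [hg]; simp only [hx]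
    rw [(h1.iteratedFDeriv ℝ m).self_of_nhds, hf0]
  -- the Taylor coefficients of `g` at the point `Q x` of `ker P`
  let u : ∀ n : ℕ, X → X [×n]→L[ℝ] F := fun n x => (n.factorial : ℝ)⁻¹ • iteratedFDeriv ℝ n g (Q x)
  have hu : ∀ n, IsSmoothBounded (u n) := fun n => by
    simpa using ((hF.iteratedFDeriv n).comp_clm Q).clm_comp
      ((n.factorial : ℝ)⁻¹ • ContinuousLinearMap.id ℝ (X [×n]→L[ℝ] F))
  obtain ⟨T, hT, hTN, hT0⟩ := exists_borel_sum hH hHid P hu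
  refine ⟨fun x => f x - f (Φ x), fun x => f (Φ x) - g x, fun x => g x - T x, T,
    hf.sub (hf.comp hΦ), (hf.comp hΦ).sub hF.contDiff, hF.contDiff.sub hT.contDiff, hT.contDiff,
    ?_, ?_, ?_, ?_, fun x => by beta_reduce; abel⟩
  · refine isFlatAlong_of_eq_zero ?_
    filter_upwards [hHid] with y hy x hx
    have : Φ x = x := by simp only [Φ, hx, hy]; rw [← hx, hP, hPQ]
    rw [this, sub_self]
  · refine isFlatAlong_of_eq_zero ?_
    filter_upwards [hHid] with y hy x hx
    have : Ψ x = Φ x := by simp only [Φ, Ψ, hx, hy]; rw [← hx, hQ]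
    simp only [hg, this, sub_self]
  · refine isFlatAlong_of_vanish (hF.sub hT) hP fun x₀ hx₀ => ?_
    refine FlatAt.iteratedFDeriv_eq_zero (hF.sub hT).contDiff
      (flatAt_of_norm_le_pow hx₀ fun N => ?_)
    obtain ⟨C, hC⟩ := hTN N
    obtain ⟨K, hK⟩ := hF.bounded N
    have h2 : Tendsto P (𝓝 x₀) (𝓝 0) := by simpa [hx₀] using P.continuous.tendsto x₀
    refine ⟨K + C, ?_⟩
    filter_upwards [h2.eventually hC] with x hx
    have h3 := norm_sub_taylor_le hF.contDiff (Q x) (P x) N (fun t _ => hK _)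
    rw [hPQ] at h3
    have h4 := hx x rfl
    rw [norm_sub_rev] at h4
    have h5 := norm_add_le_of_le h3 h4
    simp only [u, smul_apply, sub_add_sub_cancel] at h5
    rwa [add_mul]
  · refine isFlatAlong_of_vanish hT hQ fun x hx => hT0 x fun n m => ?_
    have h1 := iteratedFDeriv_clm_comp_eq_zero (((hF.iteratedFDeriv n).comp_clm Q).contDiff)
      ((n.factorial : ℝ)⁻¹ • ContinuousLinearMap.id ℝ (X [×n]→L[ℝ] F)) (x := x) (fun k => by
        refine norm_le_zero_iff.1 ((norm_iteratedFDeriv_comp_clm_le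
          (hF.iteratedFDeriv n).contDiff Q k x).trans ?_)
        rw [hx, norm_iteratedFDeriv_iteratedFDeriv, hg0, norm_zero, zero_mul]) m
    simpa using h1

/-- The equation is solvable when the right-hand side is flat at the origin: sum over forward
orbits for the parts flat along the unstable subspace `ker P`, and over backward orbits for the
parts flat along the stable subspace `ker (1 - P)`. -/
theorem exists_solution_of_flat [CompleteSpace F] [CompleteSpace X] {A : X ≃L[ℝ] X}
    (hA : IsHyperbolic (A : X →L[ℝ] X)) {H : X → X} (hH : IsSmoothBounded H)
    (hHid : ∀ᶠ x in 𝓝 (0 : X), H x = x) {f : X → F} (hf : ContDiff ℝ ∞ f)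
    (hfb : DerivsBoundedOnBounded f) (hf0 : ∀ m, iteratedFDeriv ℝ m f 0 = 0) :
    ∃ g : X → F, ContDiff ℝ ∞ g ∧ ∀ x, g (A x) - g x = f x := by
  obtain ⟨P, C, q, hP, hAP, hq0, hq1, hb, hb'⟩ := hA.exists_splitting
  let Q : X →L[ℝ] X := ContinuousLinearMap.id ℝ X - P
  have hQ : ∀ x, Q x = x - P x := fun x => rfl
  have hAsP : ∀ x, P (A.symm x) = A.symm (P x) := fun x => by
    rw [A.eq_symm_apply, hAP, A.apply_symm_apply]
  have hPdecay : ∀ (k : ℕ) x, ‖P (((A : X →L[ℝ] X) : X → X)^[k] x)‖ ≤ C * q ^ k * ‖x‖ :=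
      fun k x => by
    have : P ((A : X → X)^[k] x) = (A : X → X)^[k] (P x) :=
      (Function.Commute.iterate_right (f := P) (g := A) (fun x => (hAP x).symm) k) x
    exact (congrArg norm this).trans_le (hb k x)
  have hQdecay : ∀ (k : ℕ) x, ‖Q (((A.symm : X →L[ℝ] X) : X → X)^[k] x)‖ ≤ C * q ^ k * ‖x‖ :=
    fun k x => by
      have : Q ((A.symm : X → X)^[k] x) = (A.symm : X → X)^[k] (Q x) :=
        (Function.Commute.iterate_right (f := Q) (g := A.symm)
          (fun x => by rw [hQ, hQ, hAsP, map_sub]) k) x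
      exact (congrArg norm this).trans_le (hb' k x)
  have solP : ∀ {r : X → F}, ContDiff ℝ ∞ r → IsFlatAlong P r →
      ∃ g : X → F, ContDiff ℝ ∞ g ∧ ∀ x, g (A x) - g x = r x := fun hr hrf =>
    exists_solution_of_isFlatAlong hH hHid hq0 hq1 hPdecay hr hrf
  have solQ : ∀ {r : X → F}, ContDiff ℝ ∞ r → IsFlatAlong Q r →
      ∃ g : X → F, ContDiff ℝ ∞ g ∧ ∀ x, g (A x) - g x = r x := fun hr hrf => by
    obtain ⟨h, hh, heq⟩ := exists_solution_of_isFlatAlong hH hHid hq0 hq1 hQdecay hr hrf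
    -- `h ∘ A⁻¹ - h = r` turns into the equation for `A` by the substitution `x ↦ A x`
    refine ⟨fun x => -h (A.symm x), (hh.comp A.symm.contDiff).neg, fun x => ?_⟩
    beta_reduce
    rw [A.symm_apply_apply, ← heq x]
    simp only [ContinuousLinearEquiv.coe_coe]
    abel
  obtain ⟨f₁, f₂, f₃, f₄, h₁, h₂, h₃, h₄, hP₁, hQ₂, hP₃, hQ₄, hsum⟩ :=
    exists_isFlatAlong_add hH hHid (P := P) (Q := Q) hP (fun x => by rw [hQ, sub_add_cancel])
      hf hfb hf0
  obtain ⟨g₁, hg₁, e₁⟩ := solP h₁ hP₁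
  obtain ⟨g₂, hg₂, e₂⟩ := solQ h₂ hQ₂
  obtain ⟨g₃, hg₃, e₃⟩ := solP h₃ hP₃
  obtain ⟨g₄, hg₄, e₄⟩ := solQ h₄ hQ₄
  refine ⟨fun x => g₁ x + g₂ x + g₃ x + g₄ x, ((hg₁.add hg₂).add hg₃).add hg₄, fun x => ?_⟩
  rw [hsum, ← e₁, ← e₂, ← e₃, ← e₄]
  beta_reduce
  abel

/-- Formal solvability yields a bounded smooth `T` solving the equation up to a function that is
flat at the origin: `T` is a Borel sum of the formal solution. -/
theorem exists_formal_correction [CompleteSpace F] {A : X →L[ℝ] X} {H : X → X}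
    (hH : IsSmoothBounded H) (hHid : ∀ᶠ x in 𝓝 (0 : X), H x = x) {f : X → F}
    (hf : ContDiff ℝ ∞ f) (hfb : DerivsBoundedOnBounded f) (hf0 : f 0 = 0)
    (hsolv : FormallySolvable A f) :
    ∃ T : X → F, IsSmoothBounded T ∧
      ∀ m, iteratedFDeriv ℝ m (fun x => f x - (T (A x) - T x)) 0 = 0 := by
  have hm : ∀ n : ℕ, ∃ m : X [×n]→L[ℝ] F,
      ∀ x, m (fun _ => A x) - m (fun _ => x) = iteratedFDeriv ℝ n f 0 fun _ => x := fun n => by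
    rcases Nat.eq_zero_or_pos n with rfl | hn
    · exact ⟨0, fun x => by simp [hf0]⟩
    · obtain ⟨Q, ⟨m, hm⟩, hQ⟩ := hsolv n hn
      exact ⟨m, fun x => by rw [← hm, ← hm]; exact hQ x⟩
  choose m hm using hm
  obtain ⟨T, hT, hTN, -⟩ := exists_borel_sum hH hHid (ContinuousLinearMap.id ℝ X)
    (u := fun n _ => (n.factorial : ℝ)⁻¹ • m n) fun n => isSmoothBounded_const _
  simp only [ContinuousLinearMap.coe_id', id_eq, forall_eq, smul_apply] at hTN
  have hd : ContDiff ℝ ∞ fun x => f x - (T (A x) - T x) :=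
    hf.sub ((hT.comp_clm A).sub hT).contDiff
  refine ⟨T, hT, FlatAt.iteratedFDeriv_eq_zero hd (flatAt_of_norm_le_pow
    (P := ContinuousLinearMap.id ℝ X) rfl fun N => ?_)⟩
  obtain ⟨C, hC⟩ := hTN N
  obtain ⟨K, hK⟩ := hfb N (Metric.ball 0 1) Metric.isBounded_ball
  have hAt : Tendsto A (𝓝 0) (𝓝 0) := by simpa using A.continuous.tendsto 0
  refine ⟨K + |C| * ‖A‖ ^ N + C, ?_⟩
  filter_upwards [hC, hAt.eventually hC, Metric.ball_mem_nhds (0 : X) one_pos] with x h1 h2 hx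
  rw [mem_ball_zero_iff] at hx
  have h3 := norm_sub_taylor_le hf 0 x N (fun t ht => hK (0 + t • x) (by
    rw [mem_ball_zero_iff, zero_add, norm_smul, Real.norm_of_nonneg ht.1]
    exact (mul_le_of_le_one_left (norm_nonneg _) ht.2).trans_lt hx))
  rw [zero_add] at h3
  have h4 : C * ‖A x‖ ^ N ≤ |C| * ‖A‖ ^ N * ‖x‖ ^ N := by
    rw [mul_assoc, ← mul_pow]
    gcongr
    exacts [le_abs_self C, A.le_opNorm x]
  simp only [← hm, smul_sub, Finset.sum_sub_distrib] at h3
  have h5 := norm_add_le_of_le (norm_sub_le_of_le h3 (h2.trans h4)) h1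
  rw [add_mul, add_mul]
  refine le_trans (le_of_eq ?_) h5
  congr 1
  abel

end Main

end Blid

theorem mainTheorem3 {X : Type*} [NormedAddCommGroup X] [NormedSpace ℝ X] [CompleteSpace X]
    (A : X ≃L[ℝ] X) (hA : Blid.IsHyperbolic (A : X →L[ℝ] X))
    (hX : ∃ H : X → X, Blid.IsBlidMap ⊤ H ∧ Blid.DerivsBounded H)
    (f : X → ℂ) (hf : ContDiff ℝ ∞ f) (hfb : Blid.DerivsBoundedOnBounded f) (hf0 : f 0 = 0)
    (hsolv : Blid.FormallySolvable (A : X →L[ℝ] X) f) :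
    ∃ g : X → ℂ, ContDiff ℝ ∞ g ∧ ∀ x, g (A x) - g x = f x := by
  obtain ⟨H, hHblid, hHb⟩ := hX
  have hH : Blid.IsSmoothBounded H := ⟨hHblid.contDiff, hHb⟩
  obtain ⟨T, hT, hT0⟩ := Blid.exists_formal_correction hH hHblid.eventually_eq_id hf hfb hf0 hsolv
  have hTA := (hT.comp_clm (A : X →L[ℝ] X)).sub hT
  obtain ⟨g, hg, hgf⟩ := Blid.exists_solution_of_flat hA hH hHblid.eventually_eq_id
    (hf.sub hTA.contDiff) (hfb.sub hf hTA) hT0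
  refine ⟨fun x => g x + T x, hg.add hT.contDiff, fun x => ?_⟩
  rw [add_sub_add_comm, hgf]
  simp
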